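/- Let $\mathcal A$ be a complete and cocomplete abelian category, and let $\mathcal X,\mathcal Y$ be full subcategories of $\mathcal A$ closed under direct summands (hence under isomorphisms). A morphism $X\to M$ with $X\in\mathcal X$ is a right $\mathcal X$-approximation of $M$ if every morphism from an object of $\mathcal X$ to $M$ factors through it; left $\mathcal Y$-approximations $M\to Y$ are defined dually. A complex $C$ is right $\mathcal X$-acyclic if $\mathrm{Hom}_{\mathcal A}(X,C)$ is acyclic for all $X\in\mathcal X$, and left $\mathcal Y$-acyclic if $\mathrm{Hom}_{\mathcal A}(C,Y)$ is acyclic for all $Y\in\mathcal Y$. Assume that $(\mathcal X,\mathcal Y)$ is an admissible balanced pair. That is: - every object of $\mathcal A$ has a right $\mathcal X$-approximation and a left $\mathcal Y$-approximation; - every object $M$ has an $\mathcal X$-resolution, i.e. a right $\mathcal X$-acyclic complex $\cdots\to X_1\to X_0\to M\to 0$ with all $X_i\in\mathcal X$, which is moreover left $\mathcal Y$-acyclic, and a $\mathcal Y$-coresolution, i.e. a left $\mathcal Y$-acyclic complex $0\to M\to Y^0\to Y^1\to\cdots$ with all $Y^i\in\mathcal Y$, which is moreover right $\mathcal X$-acyclic;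 - every right $\mathcal X$-approximation is an epimorphism and every left $\mathcal Y$-approximation is a monomorphism. Let $\mathcal E$ be the class of short exact sequences in $\mathcal A$ which remain exact after applying $\mathrm{Hom}_{\mathcal A}(X,-)$ for all $X\in\mathcal X$. Let $\mathrm{Ch}(\mathcal A,\mathcal E)$ be the exact category of complexes $\cdots\to C_{n+1}\to C_n\to C_{n-1}\to\cdots$ ($n\in\mathbb Z$) over $\mathcal A$ whose conflations are the short exact sequences of complexes that lie in $\mathcal E$ in each degree, and let $\mathrm{Ext}^1_{\mathrm{Ch}(\mathcal E)}$ be its Yoneda $\mathrm{Ext}^1$. Let $\widetilde{\mathcal E}$ be the class of right $\mathcal X$-acyclic complexes in $\mathrm{Ch}(\mathcal A)$, and let $\mathcal E\text{-}\mathrm{dg}\widetilde{\mathcal X}$ be the class of complexes $X$ such that $X_n\in\mathcal X$ for all $n$ and every chain map $X\to E$ with $E\in\widetilde{\mathcal E}$ is null homotopic. Then $(\mathcal E\text{-}\mathrm{dg}\widetilde{\mathcal X},\widetilde{\mathcal E})$ is a complete cotorsion pair in $\mathrm{Ch}(\mathcal A,\mathcal E)$. That is, a complex $F$ lies in $\mathcal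 E\text{-}\mathrm{dg}\widetilde{\mathcal X}$ if and only if $\mathrm{Ext}^1_{\mathrm{Ch}(\mathcal E)}(F,E)=0$ for all $E\in\widetilde{\mathcal E}$; a complex $E$ lies in $\widetilde{\mathcal E}$ if and only if $\mathrm{Ext}^1_{\mathrm{Ch}(\mathcal E)}(F,E)=0$ for all $F\in\mathcal E\text{-}\mathrm{dg}\widetilde{\mathcal X}$; and for every complex $M$ there are conflations $0\to E\to F\to M\to 0$ and $0\to M\to E'\to F'\to 0$ with $F,F'\in\mathcal E\text{-}\mathrm{dg}\widetilde{\mathcal X}$ and $E,E'\in\widetilde{\mathcal E}$. -/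

import Mathlib

open CategoryTheory CategoryTheory.Limits Opposite

universe v u w

namespace RelHom

/-! ### Exact categories (in the sense of Quillen) -/

section ExactCategories

variable {C : Type u} [Category.{v} C] [Preadditive C]

/-- `i` is an admissible monomorphism: it is the first map of some sequence in `𝓔`. -/
def AdmissibleMono (𝓔 : ObjectProperty (ShortComplex C)) {A B : C} (i : A ⟶ B) : Prop :=
  ∃ (D : C) (p : B ⟶ D) (h : i ≫ p = 0), 𝓔 (ShortComplex.mk i p h)

/-- `p` is an admissible epimorphism: it is the second map of some sequence in `𝓔`. -/
def AdmissibleEpi (𝓔 : ObjectProperty (ShortComplex C)) {B D : C} (p : B ⟶ D) : Prop :=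
  ∃ (A : C) (i : A ⟶ B) (h : i ≫ p = 0), 𝓔 (ShortComplex.mk i p h)

/-- The axioms of an exact category for a class `𝓔` of sequences `A ⟶ B ⟶ D`. -/
structure IsExactStructure (𝓔 : ObjectProperty (ShortComplex C)) : Prop where
  isoClosed : 𝓔.IsClosedUnderIsomorphisms
  isKernel : ∀ S, 𝓔 S → Nonempty (IsLimit (KernelFork.ofι S.f S.zero))
  isCokernel : ∀ S, 𝓔 S → Nonempty (IsColimit (CokernelCofork.ofπ S.g S.zero))
  id_mono : ∀ A : C, AdmissibleMono 𝓔 (𝟙 A)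
  id_epi : ∀ A : C, AdmissibleEpi 𝓔 (𝟙 A)
  comp_mono : ∀ {A B D : C} (i : A ⟶ B) (j : B ⟶ D),
    AdmissibleMono 𝓔 i → AdmissibleMono 𝓔 j → AdmissibleMono 𝓔 (i ≫ j)
  comp_epi : ∀ {A B D : C} (p : A ⟶ B) (q : B ⟶ D),
    AdmissibleEpi 𝓔 p → AdmissibleEpi 𝓔 q → AdmissibleEpi 𝓔 (p ≫ q)
  pushout : ∀ {A B A' : C} (i : A ⟶ B) (f : A ⟶ A'), AdmissibleMono 𝓔 i →
    ∃ (B' : C) (g : B ⟶ B') (i' : A' ⟶ B'), IsPushout i f g i' ∧ AdmissibleMono 𝓔 i'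
  pullback : ∀ {B D D' : C} (p : B ⟶ D) (f : D' ⟶ D), AdmissibleEpi 𝓔 p →
    ∃ (B' : C) (g : B' ⟶ B) (p' : B' ⟶ D'), IsPullback g p' p f ∧ AdmissibleEpi 𝓔 p'

variable (C) in
/-- An exact structure on the additive category `C`. Its distinguished short exact sequences
are called conflations. -/
structure ExactStructure [HasZeroObject C] [HasBinaryBiproducts C] where
  conflation : ObjectProperty (ShortComplex C)
  isExactStructure : IsExactStructure conflation

variable [HasZeroObject C] [HasBinaryBiproducts C]

namespace ExactStructure

variable (𝓔 : ExactStructure C)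

/-- A conflation `K ↣ M ↠ F`, i.e. an extension of `F` by `K`. -/
structure Extension (F K : C) where
  middle : C
  i : K ⟶ middle
  p : middle ⟶ F
  zero : i ≫ p = 0
  conflation : 𝓔.conflation (ShortComplex.mk i p zero)

/-- Two extensions are equivalent if there is an isomorphism of the middle terms inducing the
identity on both ends. -/
def extensionSetoid (F K : C) : Setoid (𝓔.Extension F K) where
  r E E' := ∃ e : E.middle ≅ E'.middle, E.i ≫ e.hom = E'.i ∧ e.hom ≫ E'.p = E.p
  iseqv :=
    { refl := fun E => ⟨Iso.refl _, by simp, by simp⟩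
      symm := by
        rintro E E' ⟨e, h₁, h₂⟩
        exact ⟨e.symm, by simp [← h₁], by simp [← h₂]⟩
      trans := by
        rintro E E' E'' ⟨e, h₁, h₂⟩ ⟨e', h₁', h₂'⟩
        exact ⟨e ≪≫ e', by simp [← h₁', ← h₁], by simp [← h₂, ← h₂']⟩ }

/-- The Yoneda `Ext¹(F, K)` of the exact category: equivalence classes of extensions of `F`
by `K`. -/
def YonedaExt (F K : C) : Type (max u v) := Quotient (𝓔.extensionSetoid F K)

/-- `Ext¹(F, K) = 0`. As `Ext¹(F, K)` always contains the class of the split extension (the zero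
of the Baer sum), it vanishes if and only if it has at most one element. -/
def ExtVanishes (F K : C) : Prop := Subsingleton (𝓔.YonedaExt F K)

/-- `⊥𝓒`, the objects `F` with `Ext¹(F, K) = 0` for all `K` in `𝓒`. -/
def leftOrthogonal (𝓒 : ObjectProperty C) : ObjectProperty C :=
  fun F => ∀ K, 𝓒 K → 𝓔.ExtVanishes F K

/-- `𝓕⊥`, the objects `K` with `Ext¹(F, K) = 0` for all `F` in `𝓕`. -/
def rightOrthogonal (𝓕 : ObjectProperty C) : ObjectProperty C :=
  fun K => ∀ F, 𝓕 F → 𝓔.ExtVanishes F K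

/-- Cotorsion pairs in an exact category. -/
structure IsCotorsionPair (𝓕 𝓒 : ObjectProperty C) : Prop where
  left_eq : 𝓕 = 𝓔.leftOrthogonal 𝓒
  right_eq : 𝓒 = 𝓔.rightOrthogonal 𝓕

/-- Complete cotorsion pairs in an exact category: every object `M` has conflations
`K ↣ F ↠ M` and `M ↣ K' ↠ F'` with `F, F'` in `𝓕` and `K, K'` in `𝓒`. -/
structure IsCompleteCotorsionPair (𝓕 𝓒 : ObjectProperty C) : Prop
    extends 𝓔.IsCotorsionPair 𝓕 𝓒 where
  exists_precover : ∀ M : C, ∃ (K F : C) (i : K ⟶ F) (p : F ⟶ M) (h : i ≫ p = 0),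
    𝓔.conflation (ShortComplex.mk i p h) ∧ 𝓕 F ∧ 𝓒 K
  exists_preenvelope : ∀ M : C, ∃ (K F : C) (i : M ⟶ K) (p : K ⟶ F) (h : i ≫ p = 0),
    𝓔.conflation (ShortComplex.mk i p h) ∧ 𝓕 F ∧ 𝓒 K

end ExactStructure

end ExactCategories

/-! ### Approximations, relative acyclicity and balanced pairs -/

section Balanced

variable {A : Type u} [Category.{v} A]

/-- `f : X ⟶ M` is a right `𝓧`-approximation (an `𝓧`-precover) of `M`. -/
def IsRightApproximation (𝓧 : ObjectProperty A) {X M : A} (f : X ⟶ M) : Prop :=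
  𝓧 X ∧ ∀ (X' : A) (_ : 𝓧 X') (g : X' ⟶ M), ∃ l : X' ⟶ X, l ≫ f = g

/-- `f : M ⟶ Y` is a left `𝓨`-approximation (a `𝓨`-preenvelope) of `M`. -/
def IsLeftApproximation (𝓨 : ObjectProperty A) {M Y : A} (f : M ⟶ Y) : Prop :=
  𝓨 Y ∧ ∀ (Y' : A) (_ : 𝓨 Y') (g : M ⟶ Y'), ∃ l : Y ⟶ Y', f ≫ l = g

/-- Every object has a right `𝓧`-approximation. -/
def ContravariantlyFinite (𝓧 : ObjectProperty A) : Prop :=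
  ∀ M : A, ∃ (X : A) (f : X ⟶ M), IsRightApproximation 𝓧 f

/-- Every object has a left `𝓨`-approximation. -/
def CovariantlyFinite (𝓨 : ObjectProperty A) : Prop :=
  ∀ M : A, ∃ (Y : A) (f : M ⟶ Y), IsLeftApproximation 𝓨 f

variable [Preadditive A]

/-- A complex `K` is right `𝓧`-acyclic if the complex of abelian groups `Hom(X, K)` is acyclic
for every `X` in `𝓧`. -/
def RightAcyclic (𝓧 : ObjectProperty A) {ι : Type*} {c : ComplexShape ι}
    (K : HomologicalComplex A c) : Prop :=
  ∀ X : A, 𝓧 X →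
    (((preadditiveCoyoneda.obj (op X)).mapHomologicalComplex c).obj K).Acyclic

/-- A complex `K` is left `𝓨`-acyclic if the complex of abelian groups `Hom(K, Y)` is acyclic
for every `Y` in `𝓨`. -/
def LeftAcyclic (𝓨 : ObjectProperty A) {ι : Type*} {c : ComplexShape ι}
    (K : HomologicalComplex A c) : Prop :=
  ∀ Y : A, 𝓨 Y →
    (((preadditiveYoneda.obj Y).mapHomologicalComplex c.symm).obj K.op).Acyclic

/-- An `𝓧`-resolution of `M`: a right `𝓧`-acyclic complex `⋯ ⟶ X₁ ⟶ X₀ ⟶ M ⟶ 0` with all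
`Xᵢ` in `𝓧`. -/
structure XResolution (𝓧 : ObjectProperty A) (M : A) where
  deleted : ChainComplex A ℕ
  ε : deleted.X 0 ⟶ M
  d_comp_ε : deleted.d 1 0 ≫ ε = 0
  mem : ∀ i, 𝓧 (deleted.X i)
  rightAcyclic : RightAcyclic 𝓧 (deleted.augment ε d_comp_ε)

/-- The complex `⋯ ⟶ X₁ ⟶ X₀ ⟶ M ⟶ 0` (`M` sits in degree `0`, and `Xᵢ` in degree `i + 1`). -/
abbrev XResolution.complex {𝓧 : ObjectProperty A} {M : A} (R : XResolution 𝓧 M) :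
    ChainComplex A ℕ := R.deleted.augment R.ε R.d_comp_ε

/-- A `𝓨`-coresolution of `M`: a left `𝓨`-acyclic complex `0 ⟶ M ⟶ Y⁰ ⟶ Y¹ ⟶ ⋯` with all
`Yⁱ` in `𝓨`. -/
structure YCoresolution (𝓨 : ObjectProperty A) (M : A) where
  deleted : CochainComplex A ℕ
  η : M ⟶ deleted.X 0
  η_comp_d : η ≫ deleted.d 0 1 = 0
  mem : ∀ i, 𝓨 (deleted.X i)
  leftAcyclic : LeftAcyclic 𝓨 (deleted.augment η η_comp_d)

/-- The complex `0 ⟶ M ⟶ Y⁰ ⟶ Y¹ ⟶ ⋯` (`M` sits in degree `0`, and `Yⁱ` in degree `i + 1`). -/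
abbrev YCoresolution.complex {𝓨 : ObjectProperty A} {M : A} (R : YCoresolution 𝓨 M) :
    CochainComplex A ℕ := R.deleted.augment R.η R.η_comp_d

/-- Balanced pairs. -/
structure IsBalancedPair (𝓧 𝓨 : ObjectProperty A) : Prop where
  contravariantlyFinite : ContravariantlyFinite 𝓧
  covariantlyFinite : CovariantlyFinite 𝓨
  exists_resolution : ∀ M : A, ∃ R : XResolution 𝓧 M, LeftAcyclic 𝓨 R.complex
  exists_coresolution : ∀ M : A, ∃ R : YCoresolution 𝓨 M, RightAcyclic 𝓧 R.complex

/-- Admissible balanced pairs. -/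
structure IsAdmissibleBalancedPair (𝓧 𝓨 : ObjectProperty A) : Prop
    extends IsBalancedPair 𝓧 𝓨 where
  epi_of_approximation : ∀ {X M : A} (f : X ⟶ M), IsRightApproximation 𝓧 f → Epi f
  mono_of_approximation : ∀ {M Y : A} (f : M ⟶ Y), IsLeftApproximation 𝓨 f → Mono f

end Balanced

/-! ### The exact category of complexes attached to a class of objects -/

section AuxiliaryExactness

variable {B : Type u} [Category.{v} B] [Abelian B] {J : Type w}
  (G : J → B ⥤ AddCommGrpCat.{v})

/-- Auxiliary: the short exact sequences whose second map stays epic under all the `G j`. -/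
def relConflation : ObjectProperty (ShortComplex B) :=
  fun S => S.ShortExact ∧ ∀ j, Epi ((G j).map S.g)

lemma admissibleMono_relConflation_iff {A D : B} (i : A ⟶ D) :
    AdmissibleMono (relConflation G) i ↔
      Mono i ∧ ∀ j, Epi ((G j).map (cokernel.π i)) := by
  constructor
  · rintro ⟨E, p, h, hS, hG⟩
    refine ⟨hS.mono_f, fun j => ?_⟩
    have := hG j
    have := hS.epi_g
    let e := IsColimit.coconePointUniqueUpToIso (cokernelIsCokernel i) hS.gIsCokernel
    have he : cokernel.π i = p ≫ e.inv := by
      rw [Iso.eq_comp_inv]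
      exact IsColimit.comp_coconePointUniqueUpToIso_hom (cokernelIsCokernel i) hS.gIsCokernel
        WalkingParallelPair.one
    dsimp at this hG
    have := hG j
    rw [he, Functor.map_comp]
    infer_instance
  · rintro ⟨h, hG⟩
    exact ⟨_, cokernel.π i, cokernel.condition i,
      { exact := ShortComplex.exact_cokernel i
        mono_f := h
        epi_g := by dsimp; infer_instance }, hG⟩

lemma admissibleEpi_relConflation_iff {D E : B} (p : D ⟶ E) :
    AdmissibleEpi (relConflation G) p ↔ Epi p ∧ ∀ j, Epi ((G j).map p) := by
  constructor
  · rintro ⟨A, i, h, hS, hG⟩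
    exact ⟨hS.epi_g, hG⟩
  · rintro ⟨h, hG⟩
    exact ⟨_, kernel.ι p, kernel.condition p,
      { exact := ShortComplex.exact_kernel p
        mono_f := by dsimp; infer_instance
        epi_g := h }, hG⟩

/-- Auxiliary: if `p ≫ β = t` and `r ≫ α = k ≫ p`, where `r`, `t` are epic, `k ≫ t = 0` and
`α`, `β` is exact, then `p` is epic. -/
lemma epi_middle_of_exact {P₁ P₂ P₃ Q₁ Q₂ : AddCommGrpCat.{v}} (α : P₁ ⟶ P₂) (β : P₂ ⟶ P₃)
    (hαβ : α ≫ β = 0) (hex : (ShortComplex.mk α β hαβ).Exact) (k : Q₁ ⟶ Q₂) (p : Q₂ ⟶ P₂)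
    (r : Q₁ ⟶ P₁) (hr : r ≫ α = k ≫ p) (t : Q₂ ⟶ P₃) (_ : k ≫ t = 0) (ht : p ≫ β = t)
    [Epi r] [Epi t] : Epi p := by
  rw [AddCommGrpCat.epi_iff_surjective]
  intro x
  obtain ⟨y, hy⟩ := (AddCommGrpCat.epi_iff_surjective t).1 inferInstance (β x)
  rw [ShortComplex.ab_exact_iff] at hex
  obtain ⟨z, hz⟩ := hex (x - p y) (by
    have := ConcreteCategory.congr_hom ht y
    simp only [ConcreteCategory.comp_apply] at this
    simp [this, hy])
  obtain ⟨q, rfl⟩ := (AddCommGrpCat.epi_iff_surjective r).1 inferInstance z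
  refine ⟨k q + y, ?_⟩
  have := ConcreteCategory.congr_hom hr q
  simp only [ConcreteCategory.comp_apply] at this
  dsimp at hz
  rw [map_add, ← this, hz]
  simp

lemma isExactStructure_relConflation [∀ j, (G j).Additive]
    [∀ j, PreservesFiniteLimits (G j)] : IsExactStructure (relConflation G) where
  isoClosed := ⟨by
    rintro S T e ⟨hS, hG⟩
    refine ⟨ShortComplex.shortExact_of_iso e hS, fun j => ?_⟩
    have := hG j
    have h : T.g = e.inv.τ₂ ≫ S.g ≫ e.hom.τ₃ := by
      rw [← e.hom.comm₂₃, ← Category.assoc, ← ShortComplex.comp_τ₂]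
      simp
    rw [h, Functor.map_comp, Functor.map_comp]
    infer_instance⟩
  isKernel := fun S h => ⟨h.1.fIsKernel⟩
  isCokernel := fun S h => ⟨h.1.gIsCokernel⟩
  id_mono := fun A => by
    rw [admissibleMono_relConflation_iff]
    refine ⟨inferInstance, fun j => ?_⟩
    have : IsZero ((G j).obj (cokernel (𝟙 A))) :=
      Functor.map_isZero _ (isZero_cokernel_of_epi (𝟙 A))
    exact ⟨fun _ _ _ => this.eq_of_src _ _⟩
  id_epi := fun A => by
    rw [admissibleEpi_relConflation_iff]
    exact ⟨inferInstance, fun j => inferInstance⟩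
  comp_mono := fun {A D E} i k hi hk => by
    rw [admissibleMono_relConflation_iff] at *
    obtain ⟨_, hi⟩ := hi
    obtain ⟨_, hk⟩ := hk
    refine ⟨inferInstance, fun j => ?_⟩
    have h₁ := hi j
    have h₂ := hk j
    -- `0 ⟶ coker i ⟶ coker (i ≫ k) ⟶ coker k ⟶ 0`
    let a : cokernel i ⟶ cokernel (i ≫ k) := cokernel.desc i (k ≫ cokernel.π (i ≫ k))
      (by rw [← Category.assoc, cokernel.condition])
    let b : cokernel (i ≫ k) ⟶ cokernel k := cokernel.desc (i ≫ k) (cokernel.π k)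
      (by rw [Category.assoc, cokernel.condition, comp_zero])
    have hab : a ≫ b = 0 := by
      ext
      simp [a, b]
    have hsq : IsPullback i (𝟙 A) k (i ≫ k) := ⟨⟨by simp⟩, ⟨PullbackCone.IsLimit.mk _
      (fun s => s.snd) (fun s => by
        rw [← cancel_mono k, s.condition, Category.assoc]) (fun s => by simp)
      (fun s m _ h => by simpa using h)⟩⟩
    have hmono : Mono a := Abelian.mono_cokernel_map_of_isPullback hsq
    have hb : cokernel.π (i ≫ k) ≫ b = cokernel.π k := by simp [b]
    have hb' : IsColimit (CokernelCofork.ofπ b hab) := by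
      have : Epi b := epi_of_epi_fac hb
      refine CokernelCofork.IsColimit.ofπ' _ _ (fun {W} m hm => ?_)
      have hm' : k ≫ cokernel.π (i ≫ k) ≫ m = 0 := by
        have : cokernel.π i ≫ a ≫ m = 0 := by rw [hm, comp_zero]
        simpa [a] using this
      exact ⟨cokernel.desc k (cokernel.π (i ≫ k) ≫ m) hm', by ext; simp [b]⟩
    have hex : (ShortComplex.mk a b hab).Exact := ShortComplex.exact_of_g_is_cokernel _ hb'
    have hex' : ((ShortComplex.mk a b hab).map (G j)).Exact :=
      hex.map_of_mono_of_preservesKernel (G j) hmono inferInstance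
    have hepi : (G j).map (cokernel.π (i ≫ k)) ≫ (G j).map b = (G j).map (cokernel.π k) := by
      rw [← Functor.map_comp, hb]
    have hka : cokernel.π i ≫ a = k ≫ cokernel.π (i ≫ k) := by simp [a]
    refine epi_middle_of_exact ((G j).map a) ((G j).map b) _ hex' ((G j).map k) _
      ((G j).map (cokernel.π i)) ?_ ((G j).map (cokernel.π k)) ?_ hepi
    · rw [← Functor.map_comp, ← Functor.map_comp, hka]
    · rw [← Functor.map_comp, cokernel.condition, Functor.map_zero]
  comp_epi := fun p q hp hq => by
    rw [admissibleEpi_relConflation_iff] at *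
    obtain ⟨_, hp⟩ := hp
    obtain ⟨_, hq⟩ := hq
    refine ⟨epi_comp _ _, fun j => ?_⟩
    have := hp j
    have := hq j
    rw [Functor.map_comp]
    infer_instance
  pushout := fun {A D A'} i f hi => by
    rw [admissibleMono_relConflation_iff] at hi
    obtain ⟨_, hi⟩ := hi
    refine ⟨_, pushout.inl i f, pushout.inr i f, IsPushout.of_hasPushout i f, ?_⟩
    rw [admissibleMono_relConflation_iff]
    refine ⟨inferInstance, fun j => ?_⟩
    have := hi j
    let q : cokernel i ⟶ cokernel (pushout.inr i f) :=
      cokernel.map i (pushout.inr i f) f (pushout.inl i f) pushout.condition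
    have : IsIso q := isIso_cokernel_map_of_isPushout (IsPushout.of_hasPushout i f)
    have h : cokernel.π i ≫ q = pushout.inl i f ≫ cokernel.π (pushout.inr i f) := by
      simp [q]
    have h' : (G j).map (pushout.inl i f) ≫ (G j).map (cokernel.π (pushout.inr i f)) =
        (G j).map (cokernel.π i) ≫ (G j).map q := by
      rw [← Functor.map_comp, ← h, Functor.map_comp]
    exact epi_of_epi_fac h'
  pullback := fun {D E E'} p f hp => by
    rw [admissibleEpi_relConflation_iff] at hp
    obtain ⟨_, hp⟩ := hp
    refine ⟨_, pullback.fst p f, pullback.snd p f, IsPullback.of_hasPullback p f, ?_⟩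
    rw [admissibleEpi_relConflation_iff]
    refine ⟨inferInstance, fun j => ?_⟩
    have := hp j
    exact Abelian.epi_snd_of_isLimit _ _ ((IsPullback.of_hasPullback p f).map (G j)).isLimit

/-- Auxiliary: `Hom(X, -)` preserves the exactness of a short exact sequence if and only if it
preserves the surjectivity of its second map. -/
lemma shortExact_map_iff (F : B ⥤ AddCommGrpCat.{v}) [F.Additive] [PreservesFiniteLimits F]
    {S : ShortComplex B} (hS : S.ShortExact) : (S.map F).ShortExact ↔ Epi (F.map S.g) := by
  constructor
  · intro h
    exact h.epi_g
  · intro h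
    have := hS.mono_f
    exact
      { exact := hS.exact.map_of_mono_of_preservesKernel F hS.mono_f inferInstance
        mono_f := (inferInstance : Mono (F.map S.f))
        epi_g := h }

end AuxiliaryExactness

section Complexes

variable {A : Type u} [Category.{v} A] [Abelian A] (𝓧 : ObjectProperty A)

/-- The class `𝓔` of short exact sequences in `A` which remain exact after applying `Hom(X, -)`
for every `X` in `𝓧`. -/
def relShortExact : ObjectProperty (ShortComplex A) :=
  fun S => S.ShortExact ∧
    ∀ X : A, 𝓧 X → (S.map (preadditiveCoyoneda.obj (op X))).ShortExact

/-- The exact category `(A, 𝓔)`. -/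
def relExact : ExactStructure A where
  conflation := relShortExact 𝓧
  isExactStructure := by
    convert isExactStructure_relConflation
      (fun X : {X : A // 𝓧 X} => preadditiveCoyoneda.obj (op X.1)) using 1
    ext S
    constructor
    · rintro ⟨hS, h⟩
      exact ⟨hS, fun X => (h X.1 X.2).epi_g⟩
    · rintro ⟨hS, h⟩
      exact ⟨hS, fun X hX => (shortExact_map_iff _ hS).2 (h ⟨X, hX⟩)⟩

/-- The exact category `Ch(A, 𝓔)` of unbounded complexes `⋯ ⟶ Cₙ₊₁ ⟶ Cₙ ⟶ Cₙ₋₁ ⟶ ⋯`: the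
conflations are the short sequences of complexes which belong to `𝓔` in each degree. -/
def chExact : ExactStructure (ChainComplex A ℤ) where
  conflation := fun S => ∀ n : ℤ,
    (relExact 𝓧).conflation (S.map (HomologicalComplex.eval A (ComplexShape.down ℤ) n))
  isExactStructure := by
    refine Eq.subst (motive := fun P => IsExactStructure P) ?_ (isExactStructure_relConflation
      (fun X : {X : A // 𝓧 X} × ℤ =>
        HomologicalComplex.eval A (ComplexShape.down ℤ) X.2 ⋙
          preadditiveCoyoneda.obj (op X.1.1)))
    symm
    ext S
    constructor
    · intro h
      exact ⟨(HomologicalComplex.shortExact_iff_degreewise_shortExact S).2 (fun n => (h n).1),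
        fun X => ((h X.2).2 X.1.1 X.1.2).epi_g⟩
    · rintro ⟨hS, h⟩ n
      have hn := (HomologicalComplex.shortExact_iff_degreewise_shortExact S).1 hS n
      exact ⟨hn, fun X hX => (shortExact_map_iff _ hn).2 (h (⟨X, hX⟩, n))⟩

/-- The class `𝓔~` of right `𝓧`-acyclic complexes. -/
def acyclicTilde : ObjectProperty (ChainComplex A ℤ) := fun E => RightAcyclic 𝓧 E

/-- The class `𝓔-dg𝓧~` of complexes with all terms in `𝓧` every chain map from which to a
right `𝓧`-acyclic complex is null homotopic. -/
def dgTilde : ObjectProperty (ChainComplex A ℤ) :=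
  fun K => (∀ n : ℤ, 𝓧 (K.X n)) ∧
    ∀ (E : ChainComplex A ℤ) (_ : acyclicTilde 𝓧 E) (f : K ⟶ E), Nonempty (Homotopy f 0)

end Complexes

end RelHom

/-! The natural approach is a small object argument: attach disks on objects of `𝓧` along cycles
until every cycle bounds. But objects of `𝓧` need not be compact, so `Hom(X, -)` need not commute
with the colimit of the tower. Balance provides the way around. For a short exact sequence,
exactness under all `Hom(X, -)` is equivalent to exactness under all `Hom(-, Y)`
(`IsAdmissibleBalancedPair.exists_extension`,
`IsAdmissibleBalancedPair.relShortExact_of_exists_extension`). It is therefore enough that the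
colimit be left `𝓨`-acyclic (`acyclicTilde_of_left`), and `Hom(-, Y)` turns the colimit into a
limit.

Instead of a set of disks, each attachment uses one `𝓧`-approximation of each object of cycles.
Three attachments give a cofibration that is zero on the cohomology of `Hom(-, Y)`
(`exists_cofibration_killing_cohomology`). Cofibrations split in each degree, so primitives of a
cocycle can be corrected step by step and glued over the tower, a Mittag-Leffler argument
(`left_acyclic_of_sequence`). Every complex thus has a cofibration into a right `𝓧`-acyclic one.

The cokernel of that cofibration is cofibrant, hence in `dgTilde 𝓧` (`dgTilde_of_cofibrations`),
which gives the preenvelopes; a pushout in the style of Salce gives the precovers. Orthogonality is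
obstruction theory: the failure of degreewise sections to form a chain map is a chain map to the
shifted kernel (`exists_section_of_dgTilde`). Both classes are closed under retracts, so splitting
the approximation sequences identifies the orthogonals. -/

namespace RelHom

/-! ### Elementwise forms of relative acyclicity. -/

section Acyclicity

variable {A : Type u} [Category.{v} A] [Preadditive A]

lemma exactAt_coyoneda_iff {ι : Type*} {c : ComplexShape ι} (K : HomologicalComplex A c) (X : A)
    {i j k : ι} (hi : c.prev j = i) (hk : c.next j = k) :
    (((preadditiveCoyoneda.obj (op X)).mapHomologicalComplex c).obj K).ExactAt j ↔
      ∀ x : X ⟶ K.X j, x ≫ K.d j k = 0 → ∃ y : X ⟶ K.X i, y ≫ K.d i j = x := by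
  rw [HomologicalComplex.exactAt_iff' _ i j k hi hk, ShortComplex.ab_exact_iff]
  exact Iff.rfl

lemma exactAt_yoneda_iff {ι : Type*} {c : ComplexShape ι} (K : HomologicalComplex A c) (Y : A)
    {i j k : ι} (hi : c.prev j = i) (hk : c.next j = k) :
    (((preadditiveYoneda.obj Y).mapHomologicalComplex c.symm).obj K.op).ExactAt j ↔
      ∀ x : K.X j ⟶ Y, K.d i j ≫ x = 0 → ∃ y : K.X k ⟶ Y, K.d j k ≫ y = x := by
  rw [HomologicalComplex.exactAt_iff' _ k j i (show c.symm.prev j = k from hk)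
    (show c.symm.next j = i from hi), ShortComplex.ab_exact_iff]
  exact Iff.rfl

lemma acyclicTilde_iff {A : Type u} [Category.{v} A]
    [Abelian A] (𝓧 : ObjectProperty A) (E : ChainComplex A ℤ) :
    acyclicTilde 𝓧 E ↔ ∀ X, 𝓧 X → ∀ (n : ℤ) (x : X ⟶ E.X (n + 1)), x ≫ E.d (n + 1) n = 0 →
      ∃ y : X ⟶ E.X (n + 1 + 1), y ≫ E.d (n + 1 + 1) (n + 1) = x := by
  have key (X : A) (n : ℤ) := exactAt_coyoneda_iff E X (i := n + 1 + 1) (j := n + 1) (k := n)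
    (by simp) (by simp)
  constructor
  · intro h X hX n
    exact (key X n).1 (h X hX (n + 1))
  · intro h X hX n
    obtain ⟨m, rfl⟩ : ∃ m, n = m + 1 := ⟨n - 1, by ring⟩
    exact (key X m).2 (h X hX m)

end Acyclicity

/-! ### Balance: `𝓧` and `𝓨` define the same conflations. -/

section Balance

variable {A : Type u} [Category.{v} A] [Abelian A] {𝓧 𝓨 : ObjectProperty A}

lemma relShortExact_iff (S : ShortComplex A) :
    relShortExact 𝓧 S ↔
      S.ShortExact ∧ ∀ X, 𝓧 X → ∀ f : X ⟶ S.X₃, ∃ l : X ⟶ S.X₂, l ≫ S.g = f := by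
  refine and_congr_right fun hS => forall_congr' fun X => forall_congr' fun hX => ?_
  rw [shortExact_map_iff _ hS, AddCommGrpCat.epi_iff_surjective]
  exact Iff.rfl

/-- This is the beginning of a resolution acyclic on both sides. The map from the next term to
`kernel p` is itself a right approximation, hence epic; a map out of the kernel becomes a cocycle on
that term, which left `𝓨`-acyclicity extends. -/
lemma exists_approximation_extending (h : IsAdmissibleBalancedPair 𝓧 𝓨) (M : A) :
    ∃ (X : A) (p : X ⟶ M), IsRightApproximation 𝓧 p ∧
      ∀ Y, 𝓨 Y → ∀ k : kernel p ⟶ Y, ∃ l : X ⟶ Y, kernel.ι p ≫ l = k := by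
  obtain ⟨R, hR⟩ := h.exists_resolution M
  -- In the augmented complex `M` has degree `0`, where `next` takes its default value `0` and the
  -- outgoing differential vanishes: the cycle condition is empty.
  have h₀ (X : A) (hX : 𝓧 X) (g : X ⟶ M) : ∃ l : X ⟶ R.deleted.X 0, l ≫ R.ε = g :=
    (exactAt_coyoneda_iff R.complex X (i := 1) (j := 0) (k := 0) (by simp) (by simp)).1
      (R.rightAcyclic X hX 0) g comp_zero
  have h₁ (X : A) (hX : 𝓧 X) (g : X ⟶ R.deleted.X 0) (hg : g ≫ R.ε = 0) :
      ∃ l : X ⟶ R.deleted.X 1, l ≫ R.deleted.d 1 0 = g :=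
    (exactAt_coyoneda_iff R.complex X (i := 2) (j := 1) (k := 0) (by simp) (by simp)).1
      (R.rightAcyclic X hX 1) g hg
  have h₂ (Y : A) (hY : 𝓨 Y) (g : R.deleted.X 1 ⟶ Y) (hg : R.deleted.d 2 1 ≫ g = 0) :
      ∃ l : R.deleted.X 0 ⟶ Y, R.deleted.d 1 0 ≫ l = g :=
    (exactAt_yoneda_iff R.complex Y (i := 3) (j := 2) (k := 1) (by simp) (by simp)).1
      (hR Y hY 2) g hg
  refine ⟨_, R.ε, ⟨R.mem 0, h₀⟩, fun Y hY k => ?_⟩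
  let e : R.deleted.X 1 ⟶ kernel R.ε := kernel.lift _ _ R.d_comp_ε
  have he : e ≫ kernel.ι R.ε = R.deleted.d 1 0 := kernel.lift_ι _ _ _
  have : Epi e := h.epi_of_approximation e ⟨R.mem 1, fun X hX g => by
    obtain ⟨l, hl⟩ := h₁ X hX (g ≫ kernel.ι R.ε) (by simp)
    exact ⟨l, by rw [← cancel_mono (kernel.ι R.ε), Category.assoc, he, hl]⟩⟩
  obtain ⟨l, hl⟩ := h₂ Y hY (e ≫ k) (by
    have : R.deleted.d 2 1 ≫ e = 0 := by
      rw [← cancel_mono (kernel.ι R.ε), Category.assoc, he]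
      simp
    rw [reassoc_of% this, zero_comp])
  exact ⟨l, by rw [← cancel_epi e, ← hl, ← he, Category.assoc]⟩

lemma exists_approximation_lifting (h : IsAdmissibleBalancedPair 𝓧 𝓨) (M : A) :
    ∃ (Y : A) (j : M ⟶ Y), IsLeftApproximation 𝓨 j ∧
      ∀ X, 𝓧 X → ∀ k : X ⟶ cokernel j, ∃ l : X ⟶ Y, l ≫ cokernel.π j = k := by
  obtain ⟨R, hR⟩ := h.exists_coresolution M
  have h₀ (Y : A) (hY : 𝓨 Y) (g : M ⟶ Y) : ∃ l : R.deleted.X 0 ⟶ Y, R.η ≫ l = g :=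
    (exactAt_yoneda_iff R.complex Y (i := 0) (j := 0) (k := 1) (by simp) (by simp)).1
      (R.leftAcyclic Y hY 0) g ((congrArg (· ≫ g) (R.complex.shape 0 0 (by simp))).trans zero_comp)
  have h₁ (Y : A) (hY : 𝓨 Y) (g : R.deleted.X 0 ⟶ Y) (hg : R.η ≫ g = 0) :
      ∃ l : R.deleted.X 1 ⟶ Y, R.deleted.d 0 1 ≫ l = g :=
    (exactAt_yoneda_iff R.complex Y (i := 0) (j := 1) (k := 2) (by simp) (by simp)).1
      (R.leftAcyclic Y hY 1) g hg
  have h₂ (X : A) (hX : 𝓧 X) (g : X ⟶ R.deleted.X 1) (hg : g ≫ R.deleted.d 1 2 = 0) :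
      ∃ l : X ⟶ R.deleted.X 0, l ≫ R.deleted.d 0 1 = g :=
    (exactAt_coyoneda_iff R.complex X (i := 1) (j := 2) (k := 3) (by simp) (by simp)).1
      (hR X hX 2) g hg
  refine ⟨_, R.η, ⟨R.mem 0, h₀⟩, fun X hX k => ?_⟩
  let e : cokernel R.η ⟶ R.deleted.X 1 := cokernel.desc _ _ R.η_comp_d
  have he : cokernel.π R.η ≫ e = R.deleted.d 0 1 := cokernel.π_desc _ _ _
  have : Mono e := h.mono_of_approximation e ⟨R.mem 1, fun Y hY g => by
    obtain ⟨l, hl⟩ := h₁ Y hY (cokernel.π R.η ≫ g) (by simp)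
    exact ⟨l, by rw [← cancel_epi (cokernel.π R.η), ← Category.assoc, he, hl]⟩⟩
  obtain ⟨l, hl⟩ := h₂ X hX (k ≫ e) (by
    have : e ≫ R.deleted.d 1 2 = 0 := by
      rw [← cancel_epi (cokernel.π R.η), ← Category.assoc, he]
      simp
    rw [Category.assoc, this, comp_zero])
  exact ⟨l, by rw [← cancel_mono e, ← hl, ← he, Category.assoc]⟩

/-- Lift a suitable approximation `p : X ⟶ S.X₃` to `t : X ⟶ S.X₂`. Then `S.X₂` is the cokernel of
`kernel p ⟶ S.X₁ ⊞ X`, so a map out of it is a pair of maps on `S.X₁` and `X` compatible on `kernel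
p`. The second map exists because maps from `kernel p` to `Y` extend to `X`. -/
lemma IsAdmissibleBalancedPair.exists_extension (h : IsAdmissibleBalancedPair 𝓧 𝓨)
    {S : ShortComplex A} (hS : relShortExact 𝓧 S) {Y : A} (hY : 𝓨 Y) (g : S.X₁ ⟶ Y) :
    ∃ l : S.X₂ ⟶ Y, S.f ≫ l = g := by
  rw [relShortExact_iff] at hS
  obtain ⟨hS, hl⟩ := hS
  have := hS.mono_f
  have := hS.epi_g
  obtain ⟨X, p, hp, hK⟩ := exists_approximation_extending h S.X₃
  have := h.epi_of_approximation p hp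
  obtain ⟨t, ht⟩ := hl X hp.1 p
  obtain ⟨r, hr⟩ : ∃ r : kernel p ⟶ S.X₁, r ≫ S.f = kernel.ι p ≫ t :=
    ⟨hS.exact.lift (kernel.ι p ≫ t) (by simp [ht]), hS.exact.lift_f _ _⟩
  obtain ⟨l, hl⟩ := hK Y hY (r ≫ g)
  let q : S.X₁ ⊞ X ⟶ S.X₂ := biprod.desc S.f t
  let r' : kernel p ⟶ S.X₁ ⊞ X := biprod.lift r (-kernel.ι p)
  have hr' : r' ≫ q = 0 := by simp [r', q, hr]
  have : Epi q := Preadditive.epi_of_cancel_zero _ fun m hm => by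
    have h₁ : S.f ≫ m = 0 := by simpa [q] using biprod.inl ≫= hm
    have h₂ : t ≫ m = 0 := by simpa [q] using biprod.inr ≫= hm
    obtain ⟨m', rfl⟩ : ∃ m', S.g ≫ m' = m := ⟨hS.exact.desc m h₁, hS.exact.g_desc _ _⟩
    rw [← Category.assoc, ht] at h₂
    rw [zero_of_epi_comp p h₂, comp_zero]
  have hT : (ShortComplex.mk r' q hr').Exact := by
    rw [ShortComplex.exact_iff_exact_up_to_refinements]
    intro B x hx
    change B ⟶ S.X₁ ⊞ X at x
    have hx' : x ≫ biprod.fst ≫ S.f + x ≫ biprod.snd ≫ t = 0 := by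
      rw [← hx]
      simp [q, biprod.desc_eq]
    have h₂ : (x ≫ biprod.snd) ≫ p = 0 := by
      have := hx' =≫ S.g
      simpa [ht] using this
    have h₃ : x ≫ biprod.fst = -kernel.lift p _ h₂ ≫ r := by
      rw [← cancel_mono S.f, Preadditive.neg_comp, Category.assoc, Category.assoc, hr,
        kernel.lift_ι_assoc, eq_neg_iff_add_eq_zero, Category.assoc, hx']
    refine ⟨B, 𝟙 B, inferInstance, -kernel.lift p _ h₂, ?_⟩
    dsimp
    apply biprod.hom_ext
    · simp [h₃, r']
    · simp [r']
  obtain ⟨m, hm⟩ : ∃ m, q ≫ m = biprod.desc g l :=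
    ⟨hT.desc _ (by simp [r', hl]), hT.g_desc _ _⟩
  exact ⟨m, by simpa [q] using biprod.inl ≫= hm⟩

/-- Dual argument: `S.X₂` is the kernel of `S.X₃ ⊞ Y ⟶ cokernel j` for a left approximation `j` of
`S.X₁`, so a lift of `f` amounts to a compatible map to `Y`. -/
lemma IsAdmissibleBalancedPair.relShortExact_of_exists_extension
    (h : IsAdmissibleBalancedPair 𝓧 𝓨) {S : ShortComplex A} (hS : S.ShortExact)
    (hext : ∀ Y, 𝓨 Y → ∀ g : S.X₁ ⟶ Y, ∃ l : S.X₂ ⟶ Y, S.f ≫ l = g) :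
    relShortExact 𝓧 S := by
  refine (relShortExact_iff S).2 ⟨hS, fun X hX f => ?_⟩
  have := hS.mono_f
  have := hS.epi_g
  obtain ⟨Y, j, hj, hC⟩ := exists_approximation_lifting h S.X₁
  have := h.mono_of_approximation j hj
  obtain ⟨t, ht⟩ := hext Y hj.1 j
  obtain ⟨r, hr⟩ : ∃ r : S.X₃ ⟶ cokernel j, S.g ≫ r = t ≫ cokernel.π j :=
    ⟨hS.exact.desc (t ≫ cokernel.π j) (by simp [reassoc_of% ht]), hS.exact.g_desc _ _⟩
  obtain ⟨l, hl⟩ := hC X hX (f ≫ r)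
  let q : S.X₂ ⟶ S.X₃ ⊞ Y := biprod.lift S.g t
  let r' : S.X₃ ⊞ Y ⟶ cokernel j := biprod.desc r (-cokernel.π j)
  have hr' : q ≫ r' = 0 := by simp [r', q, hr]
  have : Mono q := Preadditive.mono_of_cancel_zero _ fun m hm => by
    have h₁ : m ≫ S.g = 0 := by simpa [q] using hm =≫ biprod.fst
    have h₂ : m ≫ t = 0 := by simpa [q] using hm =≫ biprod.snd
    obtain ⟨m', rfl⟩ : ∃ m', m' ≫ S.f = m := ⟨hS.exact.lift m h₁, hS.exact.lift_f _ _⟩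
    rw [Category.assoc, ht] at h₂
    rw [zero_of_comp_mono j h₂, zero_comp]
  have hT : (ShortComplex.mk q r' hr').Exact := by
    rw [ShortComplex.exact_iff_exact_up_to_refinements]
    intro B x hx
    change B ⟶ S.X₃ ⊞ Y at x
    change x ≫ r' = 0 at hx
    obtain ⟨B', π, hπ, y, hy⟩ := surjective_up_to_refinements_of_epi S.g (x ≫ biprod.fst)
    have hz : (π ≫ x ≫ biprod.snd - y ≫ t) ≫ cokernel.π j = 0 := by
      have := π ≫= hx
      simp only [r', biprod.desc_eq, Preadditive.comp_neg, comp_zero, ← sub_eq_add_neg,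
        Preadditive.comp_sub] at this
      rw [Preadditive.sub_comp, Category.assoc y t, ← hr, ← reassoc_of% hy, sub_eq_zero]
      simpa using (sub_eq_zero.1 this).symm
    obtain ⟨z, hz⟩ : ∃ z, z ≫ j = π ≫ x ≫ biprod.snd - y ≫ t :=
      ⟨(ShortComplex.exact_cokernel j).lift _ hz, (ShortComplex.exact_cokernel j).lift_f _ _⟩
    refine ⟨B', π, hπ, y + z ≫ S.f, ?_⟩
    dsimp
    apply biprod.hom_ext
    · simp [hy, q]
    · simp [q, ht, hz]
  obtain ⟨m, hm⟩ : ∃ m, m ≫ q = biprod.lift f l :=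
    ⟨hT.lift _ (by simp [r', hl]), hT.lift_f _ _⟩
  exact ⟨m, by simpa [q] using hm =≫ biprod.fst⟩

end Balance

/-! ### Attaching cells to a complex. -/

section Attach

variable {A : Type u} [Category.{v} A] [Abelian A] {U S : ℤ → A}

/-- The complex with terms `Uₙ ⊞ Sₙ` whose differential is given by `d : Uₙ₊₁ ⟶ Uₙ` and
`β : Sₙ₊₁ ⟶ Uₙ`. -/
noncomputable def attach (d : ∀ n, U (n + 1) ⟶ U n) (β : ∀ n, S (n + 1) ⟶ U n)
    (hd : ∀ n, d (n + 1) ≫ d n = 0) (hβ : ∀ n, β (n + 1) ≫ d n = 0) : ChainComplex A ℤ :=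
  ChainComplex.of (fun n => U n ⊞ S n) (fun n => biprod.desc (d n) (β n) ≫ biprod.inl)
    (fun n => by apply biprod.hom_ext' <;> simp [reassoc_of% hd, reassoc_of% hβ])

namespace attach

variable (d : ∀ n, U (n + 1) ⟶ U n) (β : ∀ n, S (n + 1) ⟶ U n)
    (hd : ∀ n, d (n + 1) ≫ d n = 0) (hβ : ∀ n, β (n + 1) ≫ d n = 0)

/-- The inclusion of `Uₙ`. -/
noncomputable def inl (n : ℤ) : U n ⟶ (attach d β hd hβ).X n :=
  (biprod.inl : U n ⟶ U n ⊞ S n)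

/-- The inclusion of `Sₙ`. -/
noncomputable def inr (n : ℤ) : S n ⟶ (attach d β hd hβ).X n :=
  (biprod.inr : S n ⟶ U n ⊞ S n)

/-- The projection to `Uₙ`. -/
noncomputable def fst (n : ℤ) : (attach d β hd hβ).X n ⟶ U n :=
  (biprod.fst : U n ⊞ S n ⟶ U n)

/-- The projection to `Sₙ`. -/
noncomputable def snd (n : ℤ) : (attach d β hd hβ).X n ⟶ S n :=
  (biprod.snd : U n ⊞ S n ⟶ S n)

@[simp]
lemma inl_fst (n : ℤ) : inl d β hd hβ n ≫ fst d β hd hβ n = 𝟙 _ := biprod.inl_fst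

@[simp]
lemma inl_fst_assoc (n : ℤ) {Z : A} (h : U n ⟶ Z) :
    inl d β hd hβ n ≫ fst d β hd hβ n ≫ h = h := by
  rw [← Category.assoc, inl_fst, Category.id_comp]

@[simp]
lemma inl_snd (n : ℤ) : inl d β hd hβ n ≫ snd d β hd hβ n = 0 := biprod.inl_snd

@[simp]
lemma inl_snd_assoc (n : ℤ) {Z : A} (h : S n ⟶ Z) :
    inl d β hd hβ n ≫ snd d β hd hβ n ≫ h = 0 := by
  rw [← Category.assoc, inl_snd, zero_comp]

@[simp]
lemma inr_fst (n : ℤ) : inr d β hd hβ n ≫ fst d β hd hβ n = 0 := biprod.inr_fst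

@[simp]
lemma inr_fst_assoc (n : ℤ) {Z : A} (h : U n ⟶ Z) :
    inr d β hd hβ n ≫ fst d β hd hβ n ≫ h = 0 := by
  rw [← Category.assoc, inr_fst, zero_comp]

@[simp]
lemma inr_snd (n : ℤ) : inr d β hd hβ n ≫ snd d β hd hβ n = 𝟙 _ := biprod.inr_snd

@[simp]
lemma inr_snd_assoc (n : ℤ) {Z : A} (h : S n ⟶ Z) :
    inr d β hd hβ n ≫ snd d β hd hβ n ≫ h = h := by
  rw [← Category.assoc, inr_snd, Category.id_comp]

@[simp]
lemma inl_d (n : ℤ) : inl d β hd hβ (n + 1) ≫ (attach d β hd hβ).d (n + 1) n =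
    d n ≫ inl d β hd hβ n := by
  have : (attach d β hd hβ).d (n + 1) n =
    (biprod.desc (d n) (β n) ≫ biprod.inl : U (n + 1) ⊞ S (n + 1) ⟶ U n ⊞ S n) :=
      ChainComplex.of_d (fun n => U n ⊞ S n) (fun n => biprod.desc (d n) (β n) ≫ biprod.inl) n
  rw [this]
  exact biprod.inl_desc_assoc _ _ _

@[simp]
lemma inl_d_assoc (n : ℤ) {Z : A} (h : (attach d β hd hβ).X n ⟶ Z) :
    inl d β hd hβ (n + 1) ≫ (attach d β hd hβ).d (n + 1) n ≫ h = d n ≫ inl d β hd hβ n ≫ h := by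
  rw [← Category.assoc, inl_d, Category.assoc]

@[simp]
lemma inr_d (n : ℤ) : inr d β hd hβ (n + 1) ≫ (attach d β hd hβ).d (n + 1) n =
    β n ≫ inl d β hd hβ n := by
  have : (attach d β hd hβ).d (n + 1) n =
    (biprod.desc (d n) (β n) ≫ biprod.inl : U (n + 1) ⊞ S (n + 1) ⟶ U n ⊞ S n) :=
      ChainComplex.of_d (fun n => U n ⊞ S n) (fun n => biprod.desc (d n) (β n) ≫ biprod.inl) n
  rw [this]
  exact biprod.inr_desc_assoc _ _ _

@[simp]
lemma inr_d_assoc (n : ℤ) {Z : A} (h : (attach d β hd hβ).X n ⟶ Z) :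
    inr d β hd hβ (n + 1) ≫ (attach d β hd hβ).d (n + 1) n ≫ h = β n ≫ inl d β hd hβ n ≫ h := by
  rw [← Category.assoc, inr_d, Category.assoc]

variable {d β hd hβ}

lemma hom_ext {n : ℤ} {X : A} {f g : X ⟶ (attach d β hd hβ).X n}
    (h₁ : f ≫ fst d β hd hβ n = g ≫ fst d β hd hβ n)
    (h₂ : f ≫ snd d β hd hβ n = g ≫ snd d β hd hβ n) : f = g :=
  biprod.hom_ext (X := U n) (Y := S n) f g h₁ h₂

lemma hom_ext' {n : ℤ} {X : A} {f g : (attach d β hd hβ).X n ⟶ X}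
    (h₁ : inl d β hd hβ n ≫ f = inl d β hd hβ n ≫ g)
    (h₂ : inr d β hd hβ n ≫ f = inr d β hd hβ n ≫ g) : f = g :=
  biprod.hom_ext' (X := U n) (Y := S n) f g h₁ h₂

variable (d β hd hβ)

@[simp]
lemma d_fst (n : ℤ) : (attach d β hd hβ).d (n + 1) n ≫ fst d β hd hβ n =
    fst d β hd hβ (n + 1) ≫ d n + snd d β hd hβ (n + 1) ≫ β n := by
  apply hom_ext' <;> simp

@[simp]
lemma d_snd (n : ℤ) : (attach d β hd hβ).d (n + 1) n ≫ snd d β hd hβ n = 0 := by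
  apply hom_ext' <;> simp

@[simp]
lemma d_snd_assoc (n : ℤ) {Z : A} (h : S n ⟶ Z) :
    (attach d β hd hβ).d (n + 1) n ≫ snd d β hd hβ n ≫ h = 0 := by
  rw [← Category.assoc, d_snd, zero_comp]

end attach

end Attach

/-! ### Contractible complexes on graded objects. -/

section Contractible

variable {A : Type u} [Category.{v} A] [Abelian A]

/-- The contractible complex `⋯ ⟶ Vₙ₊₂ ⊞ Vₙ₊₁ ⟶ Vₙ₊₁ ⊞ Vₙ ⟶ ⋯` attached to a graded object. -/
noncomputable def contractible (V : ℤ → A) : ChainComplex A ℤ :=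
  attach (U := fun n => V (n + 1)) (S := V) (fun _ => 0) (fun _ => 𝟙 _) (by simp) (by simp)

namespace contractible

variable (V : ℤ → A)

/-- The inclusion of `Vₙ₊₁` in degree `n`. -/
noncomputable def inl (n : ℤ) : V (n + 1) ⟶ (contractible V).X n :=
  attach.inl (U := fun n => V (n + 1)) (S := V) (fun _ => 0) (fun _ => 𝟙 _)
    (by simp) (by simp) n

/-- The inclusion of `Vₙ` in degree `n`. -/
noncomputable def inr (n : ℤ) : V n ⟶ (contractible V).X n :=
  attach.inr (U := fun n => V (n + 1)) (S := V) (fun _ => 0) (fun _ => 𝟙 _)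
    (by simp) (by simp) n

/-- The projection to `Vₙ₊₁` in degree `n`. -/
noncomputable def fst (n : ℤ) : (contractible V).X n ⟶ V (n + 1) :=
  attach.fst (U := fun n => V (n + 1)) (S := V) (fun _ => 0) (fun _ => 𝟙 _)
    (by simp) (by simp) n

/-- The projection to `Vₙ` in degree `n`. -/
noncomputable def snd (n : ℤ) : (contractible V).X n ⟶ V n :=
  attach.snd (U := fun n => V (n + 1)) (S := V) (fun _ => 0) (fun _ => 𝟙 _)
    (by simp) (by simp) n

@[simp]
lemma inl_fst (n : ℤ) : inl V n ≫ fst V n = 𝟙 _ :=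
  attach.inl_fst (U := fun n => V (n + 1)) (S := V) (fun _ => 0) (fun _ => 𝟙 _)
    (by simp) (by simp) n

@[simp]
lemma inl_fst_assoc (n : ℤ) {Z : A} (h : V (n + 1) ⟶ Z) :
    inl V n ≫ fst V n ≫ h = h := by
  rw [← Category.assoc, inl_fst, Category.id_comp]

@[simp]
lemma inl_snd (n : ℤ) : inl V n ≫ snd V n = 0 :=
  attach.inl_snd (U := fun n => V (n + 1)) (S := V) (fun _ => 0) (fun _ => 𝟙 _)
    (by simp) (by simp) n

@[simp]
lemma inl_snd_assoc (n : ℤ) {Z : A} (h : V n ⟶ Z) :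
    inl V n ≫ snd V n ≫ h = 0 := by
  rw [← Category.assoc, inl_snd, zero_comp]

@[simp]
lemma inr_fst (n : ℤ) : inr V n ≫ fst V n = 0 :=
  attach.inr_fst (U := fun n => V (n + 1)) (S := V) (fun _ => 0) (fun _ => 𝟙 _)
    (by simp) (by simp) n

@[simp]
lemma inr_fst_assoc (n : ℤ) {Z : A} (h : V (n + 1) ⟶ Z) :
    inr V n ≫ fst V n ≫ h = 0 := by
  rw [← Category.assoc, inr_fst, zero_comp]

@[simp]
lemma inr_snd (n : ℤ) : inr V n ≫ snd V n = 𝟙 _ :=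
  attach.inr_snd (U := fun n => V (n + 1)) (S := V) (fun _ => 0) (fun _ => 𝟙 _)
    (by simp) (by simp) n

@[simp]
lemma inr_snd_assoc (n : ℤ) {Z : A} (h : V n ⟶ Z) :
    inr V n ≫ snd V n ≫ h = h := by
  rw [← Category.assoc, inr_snd, Category.id_comp]

@[simp]
lemma inl_d (n : ℤ) : inl V (n + 1) ≫ (contractible V).d (n + 1) n = 0 :=
  (attach.inl_d (U := fun n => V (n + 1)) (S := V) (fun _ => 0) (fun _ => 𝟙 _)
    (by simp) (by simp) n).trans zero_comp

@[simp]
lemma inl_d_assoc (n : ℤ) {Z : A} (h : (contractible V).X n ⟶ Z) :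
    inl V (n + 1) ≫ (contractible V).d (n + 1) n ≫ h = 0 := by
  rw [← Category.assoc, inl_d, zero_comp]

@[simp]
lemma inr_d (n : ℤ) : inr V (n + 1) ≫ (contractible V).d (n + 1) n = inl V n :=
  (attach.inr_d (U := fun n => V (n + 1)) (S := V) (fun _ => 0) (fun _ => 𝟙 _)
    (by simp) (by simp) n).trans (Category.id_comp (inl V n))

@[simp]
lemma inr_d_assoc (n : ℤ) {Z : A} (h : (contractible V).X n ⟶ Z) :
    inr V (n + 1) ≫ (contractible V).d (n + 1) n ≫ h = inl V n ≫ h := by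
  rw [← Category.assoc, inr_d]

variable {V}

lemma hom_ext {n : ℤ} {X : A} {f g : X ⟶ (contractible V).X n}
    (h₁ : f ≫ fst V n = g ≫ fst V n) (h₂ : f ≫ snd V n = g ≫ snd V n) : f = g :=
  attach.hom_ext (U := fun n => V (n + 1)) (S := V) h₁ h₂

lemma hom_ext' {n : ℤ} {X : A} {f g : (contractible V).X n ⟶ X}
    (h₁ : inl V n ≫ f = inl V n ≫ g) (h₂ : inr V n ≫ f = inr V n ≫ g) : f = g :=
  attach.hom_ext' (U := fun n => V (n + 1)) (S := V) h₁ h₂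

variable (V)

@[simp]
lemma d_fst (n : ℤ) : (contractible V).d (n + 1) n ≫ fst V n = snd V (n + 1) := by
  apply hom_ext' <;> simp

@[simp]
lemma d_fst_assoc (n : ℤ) {Z : A} (h : V (n + 1) ⟶ Z) :
    (contractible V).d (n + 1) n ≫ fst V n ≫ h = snd V (n + 1) ≫ h := by
  rw [← Category.assoc, d_fst]

@[simp]
lemma d_snd (n : ℤ) : (contractible V).d (n + 1) n ≫ snd V n = 0 := by
  apply hom_ext' <;> simp

@[simp]
lemma d_snd_assoc (n : ℤ) {Z : A} (h : V n ⟶ Z) :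
    (contractible V).d (n + 1) n ≫ snd V n ≫ h = 0 := by
  rw [← Category.assoc, d_snd, zero_comp]

/-- Cofreeness of the contractible complex: the components in `V (n + 1)` are arbitrary and the
differential then forces the others. -/
lemma exists_to (C : ChainComplex A ℤ) (f : ∀ n, C.X n ⟶ V (n + 1)) :
    ∃ φ : C ⟶ contractible V, ∀ n, φ.f n ≫ fst V n = f n := by
  have hg (m : ℤ) : ∃ g : C.X m ⟶ V m, ∀ n, ∀ h : n + 1 = m,
      g = C.d m n ≫ f n ≫ eqToHom (by rw [h]) := by
    obtain ⟨n, rfl⟩ : ∃ n, m = n + 1 := ⟨m - 1, by ring⟩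
    refine ⟨C.d (n + 1) n ≫ f n, fun n' h => ?_⟩
    obtain rfl : n' = n := by omega
    simp
  choose g hg using hg
  replace hg (n : ℤ) : g (n + 1) = C.d (n + 1) n ≫ f n := by simpa using hg (n + 1) n rfl
  refine ⟨⟨fun n => f n ≫ inl V n + g n ≫ inr V n, ?_⟩, fun n => by simp⟩
  rintro _ n rfl
  obtain ⟨n, rfl⟩ : ∃ m, n = m + 1 := ⟨n - 1, by ring⟩
  apply hom_ext <;> simp [hg]

variable {V}

/-- A family of morphisms `Vₙ ⟶ Cₙ` induces a chain map from the contractible complex on `V`. -/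
noncomputable def desc {C : ChainComplex A ℤ} (g : ∀ n, V n ⟶ C.X n) :
    contractible V ⟶ C where
  f n := fst V n ≫ g (n + 1) ≫ C.d (n + 1) n + snd V n ≫ g n
  comm' := by
    rintro _ n rfl
    apply hom_ext' <;> simp

/-- The functoriality of `contractible`. -/
noncomputable def map {W : ℤ → A} (q : ∀ n, V n ⟶ W n) : contractible V ⟶ contractible W where
  f n := fst V n ≫ q (n + 1) ≫ inl W n + snd V n ≫ q n ≫ inr W n
  comm' := by
    rintro _ n rfl
    apply hom_ext' <;> simp

lemma snd_eq_zero_of_cycle {n : ℤ} {X : A} (x : X ⟶ (contractible V).X (n + 1))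
    (hx : x ≫ (contractible V).d (n + 1) n = 0) : x ≫ snd V (n + 1) = 0 := by
  simpa using hx =≫ fst V n

end contractible

end Contractible

/-! ### Conflations of complexes, degree by degree. -/

section Conflations

variable {A : Type u} [Category.{v} A] [Abelian A] {𝓧 : ObjectProperty A}

lemma chExact_conflation_iff (S : ShortComplex (ChainComplex A ℤ)) :
    (chExact 𝓧).conflation S ↔ S.ShortExact ∧
      ∀ n X, 𝓧 X → ∀ f : X ⟶ S.X₃.X n, ∃ l : X ⟶ S.X₂.X n, l ≫ S.g.f n = f := by
  rw [HomologicalComplex.shortExact_iff_degreewise_shortExact, ← forall_and]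
  exact forall_congr' fun n => relShortExact_iff _

lemma exists_degreewise_lift {S : ShortComplex (ChainComplex A ℤ)} (hS : S.ShortExact) (n : ℤ)
    {X : A} (x : X ⟶ S.X₂.X n) (hx : x ≫ S.g.f n = 0) : ∃ y, y ≫ S.f.f n = x := by
  have h := (HomologicalComplex.shortExact_iff_degreewise_shortExact S).1 hS n
  have := h.mono_f
  exact ⟨h.exact.lift x hx, h.exact.lift_f _ _⟩

end Conflations

/-! ### Trivial fibrations and cofibrations. -/

section TrivialFibrations

variable {A : Type u} [Category.{v} A] [Abelian A] (𝓧 : ObjectProperty A)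

/-- The chain maps `p` with the right lifting property with respect to the inclusions of the
spheres on objects of `𝓧` into the corresponding disks. -/
def trivialFibrations : MorphismProperty (ChainComplex A ℤ) := fun E B p =>
  ∀ X, 𝓧 X → ∀ (n : ℤ) (x : X ⟶ E.X (n + 1)) (y : X ⟶ B.X (n + 1 + 1)),
    x ≫ E.d (n + 1) n = 0 → y ≫ B.d (n + 1 + 1) (n + 1) = x ≫ p.f (n + 1) →
      ∃ z : X ⟶ E.X (n + 1 + 1), z ≫ E.d (n + 1 + 1) (n + 1) = x ∧ z ≫ p.f (n + 1 + 1) = y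

/-- The chain maps with the left lifting property with respect to the trivial fibrations. -/
abbrev cofibrations : MorphismProperty (ChainComplex A ℤ) := (trivialFibrations 𝓧).llp

variable {𝓧}

lemma exists_lift_of_cofibrations {C D E B : ChainComplex A ℤ} {i : C ⟶ D} {p : E ⟶ B}
    (hi : cofibrations 𝓧 i) (hp : trivialFibrations 𝓧 p) {f : C ⟶ E} {g : D ⟶ B}
    (w : f ≫ p = i ≫ g) : ∃ l : D ⟶ E, i ≫ l = f ∧ l ≫ p = g := by
  have := hi p hp
  have sq : CommSq f i p g := ⟨w⟩
  exact ⟨sq.lift, sq.fac_left, sq.fac_right⟩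

lemma trivialFibrations_of_isZero {E B : ChainComplex A ℤ} (hE : acyclicTilde 𝓧 E)
    (hB : IsZero B) (p : E ⟶ B) : trivialFibrations 𝓧 p := by
  intro X hX n x y hx _
  obtain ⟨z, hz⟩ := (acyclicTilde_iff 𝓧 E).1 hE X hX n x hx
  exact ⟨z, hz, ((HomologicalComplex.eval A _ (n + 1 + 1)).map_isZero hB).eq_of_tgt _ _⟩

variable (𝓧) in
lemma acyclicTilde_contractible (V : ℤ → A) : acyclicTilde 𝓧 (contractible V) := by
  rw [acyclicTilde_iff]
  intro X _ n x hx
  refine ⟨x ≫ contractible.fst V _ ≫ contractible.inr V _, ?_⟩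
  apply contractible.hom_ext
  · simp
  · simp [contractible.snd_eq_zero_of_cycle x hx]

/-- A cycle has no `snd` component, so `x` determines the `snd` component of the lift. The `fst`
component is free and is found by lifting through `q`. -/
lemma trivialFibrations_contractible_map {V W : ℤ → A} (q : ∀ n, V n ⟶ W n)
    (hq : ∀ n, IsRightApproximation 𝓧 (q n)) : trivialFibrations 𝓧 (contractible.map q) := by
  intro X hX n x y hx hy
  obtain ⟨l, hl⟩ := (hq (n + 1 + 1 + 1)).2 X hX (y ≫ contractible.fst W _)
  have hx' := contractible.snd_eq_zero_of_cycle x hx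
  have hy' : y ≫ contractible.snd W _ = x ≫ contractible.fst V _ ≫ q (n + 1 + 1) := by
    simpa [contractible.map] using hy =≫ contractible.fst W _
  refine ⟨l ≫ contractible.inl V _ + x ≫ contractible.fst V _ ≫ contractible.inr V _, ?_, ?_⟩
  · apply contractible.hom_ext
    · simp
    · simp [hx']
  · apply contractible.hom_ext
    · simp [contractible.map, hl]
    · simp [contractible.map, hy']

/-- Lifting a chain map through this cover by disks amounts to contracting it. Once `x` fixes one
component of the lift, what remains of `y` is a cycle of `E`, hence a boundary on objects of `𝓧`. -/
lemma trivialFibrations_contractible_desc {E : ChainComplex A ℤ} (hE : acyclicTilde 𝓧 E) :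
    trivialFibrations 𝓧 (contractible.desc fun n => 𝟙 (E.X n)) := by
  intro X hX n x y hx hy
  have hx' := contractible.snd_eq_zero_of_cycle x hx
  have hy' : (y - x ≫ contractible.fst E.X _) ≫ E.d (n + 1 + 1) (n + 1) = 0 := by
    rw [Preadditive.sub_comp, hy]
    simp [contractible.desc, hx']
  obtain ⟨e, he⟩ := (acyclicTilde_iff 𝓧 E).1 hE X hX (n + 1) _ hy'
  refine ⟨e ≫ contractible.inl E.X _ + x ≫ contractible.fst E.X _ ≫ contractible.inr E.X _,
    ?_, ?_⟩
  · apply contractible.hom_ext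
    · simp
    · simp [hx']
  · simp [contractible.desc, he]

/-- A cofibration splits in each degree. -/
lemma exists_retraction_of_cofibrations {C D : ChainComplex A ℤ} {i : C ⟶ D}
    (hi : cofibrations 𝓧 i) (n : ℤ) : ∃ r : D.X n ⟶ C.X n, i.f n ≫ r = 𝟙 _ := by
  -- The shift by `-1` makes the `fst` component in degree `n` a copy of `C.X n`. As the
  -- contractible complex is acyclic, `φ` extends along `i`, and this component of the extension is
  -- the retraction.
  obtain ⟨φ, hφ⟩ := contractible.exists_to (fun m => C.X (m - 1)) C
    (fun n => (C.XIsoOfEq (by ring)).hom)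
  obtain ⟨Z, hZ⟩ : ∃ Z : ChainComplex A ℤ, IsZero Z := HasZeroObject.zero
  obtain ⟨l, hl, -⟩ := exists_lift_of_cofibrations hi (trivialFibrations_of_isZero
    (acyclicTilde_contractible 𝓧 fun m => C.X (m - 1)) hZ (hZ.from_ _)) (f := φ)
    (g := hZ.from_ D) (hZ.eq_of_tgt _ _)
  have hs : i.f n ≫ l.f n = φ.f n := by rw [← HomologicalComplex.comp_f, hl]
  refine ⟨l.f n ≫ contractible.fst _ n ≫ (C.XIsoOfEq (by ring)).hom, ?_⟩
  rw [reassoc_of% hs, reassoc_of% (hφ n)]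
  simp

/-- Two lifting problems. Lifting the cofree map through a contractible complex on approximations
makes each `F.X n` a retract of an object of `𝓧`. Lifting `f` through the disk cover of `E` gives a
null homotopy. -/
lemma dgTilde_of_cofibrations [𝓧.IsStableUnderRetracts] (h𝓧 : ContravariantlyFinite 𝓧)
    {Z F : ChainComplex A ℤ} (hZ : IsZero Z) {i : Z ⟶ F} (hi : cofibrations 𝓧 i) :
    dgTilde 𝓧 F := by
  constructor
  · intro n
    choose W q hq using h𝓧
    obtain ⟨φ, hφ⟩ := contractible.exists_to (fun m => F.X (m - 1)) F
      (fun n => (F.XIsoOfEq (by ring)).hom)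
    obtain ⟨l, -, hl⟩ := exists_lift_of_cofibrations hi (trivialFibrations_contractible_map
      (fun m => q (F.X (m - 1))) (fun m => hq _)) (f := hZ.to_ _) (g := φ) (hZ.eq_of_src _ _)
    have hs : l.f n ≫ (contractible.map (fun m => q (F.X (m - 1)))).f n = φ.f n := by
      rw [← HomologicalComplex.comp_f, hl]
    exact 𝓧.prop_of_retract
      { i := l.f n ≫ contractible.fst _ n
        r := q _ ≫ (F.XIsoOfEq (by ring)).hom
        retract := by
          have h₁ := hs =≫ contractible.fst _ n
          rw [hφ] at h₁
          simp only [contractible.map, Preadditive.comp_add, Category.assoc,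
            Preadditive.add_comp, contractible.inl_fst, contractible.inr_fst, comp_zero, add_zero,
            Category.comp_id] at h₁
          rw [Category.assoc, reassoc_of% h₁]
          simp } (hq (F.X (n + 1 - 1))).1
  · intro E hE f
    obtain ⟨l, -, hl⟩ := exists_lift_of_cofibrations hi (trivialFibrations_contractible_desc hE)
      (f := hZ.to_ _) (g := f) (hZ.eq_of_src _ _)
    let g (n : ℤ) : F.X n ⟶ E.X (n + 1) := l.f n ≫ contractible.fst _ n
    have hg (n : ℤ) : g n ≫ E.d (n + 1) n + l.f n ≫ contractible.snd _ n = f.f n := by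
      have : l.f n ≫ (contractible.desc fun n => 𝟙 (E.X n)).f n = f.f n := by
        rw [← HomologicalComplex.comp_f, hl]
      simpa [g, contractible.desc] using this
    have hg' (n : ℤ) : l.f (n + 1) ≫ contractible.snd _ (n + 1) =
        F.d (n + 1) n ≫ g n := by
      have := l.comm (n + 1) n =≫ contractible.fst _ n
      rwa [Category.assoc, Category.assoc, contractible.d_fst] at this
    let H (i j : ℤ) (hij : (ComplexShape.down ℤ).Rel j i) : F.X i ⟶ E.X j :=
      g i ≫ (E.XIsoOfEq hij).hom
    have : f = Homotopy.nullHomotopicMap' H := by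
      ext n
      obtain ⟨n, rfl⟩ : ∃ m, n = m + 1 := ⟨n - 1, by ring⟩
      rw [Homotopy.nullHomotopicMap'_f (k₂ := n + 1 + 1) (k₀ := n) (by simp) (by simp), ← hg, hg']
      simp [H, add_comm]
    rw [this]
    exact ⟨Homotopy.nullHomotopy' _⟩

end TrivialFibrations

/-! ### Splitting of extensions by obstruction theory. -/

section Extensions

variable {A : Type u} [Category.{v} A] [Abelian A] {𝓧 : ObjectProperty A}

/-- The complex `E` shifted by one. -/
abbrev shiftOne (E : ChainComplex A ℤ) : ChainComplex A ℤ where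
  X n := E.X (n - 1)
  d i j := -E.d (i - 1) (j - 1)
  shape i j hij := by
    rw [E.shape, neg_zero]
    exact fun h => hij (by simp at h ⊢; omega)
  d_comp_d' := by simp

lemma acyclicTilde_shiftOne {E : ChainComplex A ℤ} (hE : acyclicTilde 𝓧 E) :
    acyclicTilde 𝓧 (shiftOne E) := by
  rw [acyclicTilde_iff]
  intro X hX n x hx
  obtain ⟨y, hy⟩ := (exactAt_coyoneda_iff E X (i := n + 1 + 1 - 1) (j := n + 1 - 1) (k := n - 1)
    (ComplexShape.prev_eq' _ (by simp)) (ComplexShape.next_eq' _ (by simp))).1 (hE X hX _) x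
    (by rw [← neg_eq_zero, ← Preadditive.comp_neg]; exact hx)
  exact ⟨-y, by rw [Preadditive.neg_comp_neg]; exact hy⟩

/-- A conflation with cokernel in `dgTilde 𝓧` and right `𝓧`-acyclic kernel splits. -/
lemma exists_section_of_dgTilde {S : ShortComplex (ChainComplex A ℤ)}
    (hS : (chExact 𝓧).conflation S) (hE : acyclicTilde 𝓧 S.X₁) (hF : dgTilde 𝓧 S.X₃) :
    ∃ t : S.X₃ ⟶ S.X₂, t ≫ S.g = 𝟙 _ := by
  obtain ⟨hS, hlift⟩ := (chExact_conflation_iff S).1 hS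
  have hs (n : ℤ) : ∃ s : S.X₃.X n ⟶ S.X₂.X n, s ≫ S.g.f n = 𝟙 _ := hlift n _ (hF.1 n) (𝟙 _)
  choose s hs using hs
  have := hS.mono_f
  have hfg (n : ℤ) : S.f.f n ≫ S.g.f n = 0 := by
    rw [← HomologicalComplex.comp_f, S.zero, HomologicalComplex.zero_f]
  -- `δ` measures the failure of the degreewise sections to commute with the differentials; it lands
  -- in the kernel and forms a chain map to its shift.
  have hδ (n : ℤ) : ∃ δ : S.X₃.X n ⟶ S.X₁.X (n - 1), δ ≫ S.f.f (n - 1) =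
      s n ≫ S.X₂.d n (n - 1) - S.X₃.d n (n - 1) ≫ s (n - 1) := exists_degreewise_lift hS _ _ (by
    rw [Preadditive.sub_comp, Category.assoc, Category.assoc, hs, ← S.g.comm, ← Category.assoc, hs]
    simp)
  choose δ hδ using hδ
  replace hδ (m n : ℤ) (h : m - 1 = n) : δ m ≫ (S.X₁.XIsoOfEq h).hom ≫ S.f.f n =
      s m ≫ S.X₂.d m n - S.X₃.d m n ≫ s n := by
    subst h
    simpa using hδ m
  let Δ : S.X₃ ⟶ shiftOne S.X₁ :=
    { f := δ
      comm' := by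
        rintro _ n rfl
        have h₁ : δ (n + 1) ≫ S.X₁.d (n + 1 - 1) (n - 1) =
          δ (n + 1) ≫ (S.X₁.XIsoOfEq (by ring)).hom ≫ S.X₁.d n (n - 1) := by simp
        rw [Preadditive.comp_neg, h₁, ← cancel_mono (S.f.f (n - 1))]
        have h₂ := hδ n (n - 1) rfl
        have h₃ := hδ (n + 1) n (by ring)
        simp only [HomologicalComplex.XIsoOfEq_rfl, Iso.refl_hom, Category.id_comp] at h₂
        rw [Preadditive.neg_comp, Category.assoc, Category.assoc, Category.assoc, ← S.f.comm,
          reassoc_of% h₃, h₂]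
        simp }
  obtain ⟨H⟩ := hF.2 _ (acyclicTilde_shiftOne hE) Δ
  -- A null homotopy of the obstruction is exactly the correction turning `s` into a chain map.
  let k (n : ℤ) : S.X₃.X n ⟶ S.X₁.X n := H.hom n (n + 1) ≫ (S.X₁.XIsoOfEq (by ring)).hom
  have hk (n : ℤ) : δ (n + 1) ≫ (S.X₁.XIsoOfEq (by ring)).hom =
      S.X₃.d (n + 1) n ≫ k n - k (n + 1) ≫ S.X₁.d (n + 1) n := by
    have := H.comm (n + 1) =≫ (S.X₁.XIsoOfEq (by ring : n + 1 - 1 = n)).hom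
    rw [dNext_eq (i' := n) _ (by simp), prevD_eq (j' := n + 1 + 1) _ (by simp)] at this
    simpa [k, Δ, sub_eq_add_neg] using this
  refine ⟨⟨fun n => s n + k n ≫ S.f.f n, ?_⟩, ?_⟩
  · rintro _ n rfl
    have h₁ := hδ (n + 1) n (by ring)
    rw [reassoc_of% (hk n)] at h₁
    simp only [Preadditive.sub_comp, Category.assoc] at h₁
    simp only [Preadditive.add_comp, Preadditive.comp_add, Category.assoc, S.f.comm]
    rw [sub_eq_sub_iff_add_eq_add] at h₁
    rw [← h₁]
    abel
  · ext n
    simp [hs, hfg]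

end Extensions

/-! ### Attaching cells along approximations of cycles. -/

section CycleApproximations

variable {A : Type u} [Category.{v} A] [Abelian A]

/-- Right `𝓧`-approximations of the objects of cycles of a complex. -/
structure CycleApproximation (𝓧 : ObjectProperty A) (C : ChainComplex A ℤ) where
  S : ℤ → A
  β : ∀ n, S (n + 1) ⟶ C.X n
  mem : ∀ n, 𝓧 (S n)
  β_d : ∀ n, β (n + 1) ≫ C.d (n + 1) n = 0
  exists_lift : ∀ (n : ℤ) (X : A), 𝓧 X → ∀ x : X ⟶ C.X (n + 1), x ≫ C.d (n + 1) n = 0 →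
    ∃ l : X ⟶ S (n + 1 + 1), l ≫ β (n + 1) = x

lemma nonempty_cycleApproximation {𝓧 : ObjectProperty A} (h𝓧 : ContravariantlyFinite 𝓧)
    (C : ChainComplex A ℤ) : Nonempty (CycleApproximation 𝓧 C) := by
  have key (m : ℤ) : ∃ (S : A) (β : ∀ n, n + 1 = m → (S ⟶ C.X n)), 𝓧 S ∧
      ∀ n (hn : n + 1 = m) k, k + 1 = n → β n hn ≫ C.d n k = 0 ∧
        ∀ (X : A), 𝓧 X → ∀ x : X ⟶ C.X n, x ≫ C.d n k = 0 → ∃ l : X ⟶ S, l ≫ β n hn = x := by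
    obtain ⟨k, rfl⟩ : ∃ k, m = k + 1 + 1 := ⟨m - 2, by ring⟩
    obtain ⟨S, q, hS, hq⟩ := h𝓧 (kernel (C.d (k + 1) k))
    refine ⟨S, fun n hn => q ≫ kernel.ι _ ≫ (C.XIsoOfEq (by omega)).hom, hS, fun n hn k' hk => ?_⟩
    obtain rfl : n = k + 1 := by omega
    obtain rfl : k' = k := by omega
    refine ⟨by simp, fun X hX x hx => ?_⟩
    obtain ⟨l, hl⟩ := hq X hX (kernel.lift _ x hx)
    exact ⟨l, by simp [reassoc_of% hl]⟩
  choose S β hS hβ using key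
  exact ⟨{
    S := S
    β := fun n => β (n + 1) n rfl
    mem := hS
    β_d := fun n => (hβ _ _ _ n rfl).1
    exists_lift := fun n => (hβ _ _ _ n rfl).2 }⟩

namespace CycleApproximation

variable {𝓧 𝓨 : ObjectProperty A} {C : ChainComplex A ℤ} (P : CycleApproximation 𝓧 C)

/-- The complex obtained from `C` by attaching cells along a cycle approximation. -/
noncomputable abbrev complex : ChainComplex A ℤ :=
  attach (U := C.X) (fun n => C.d (n + 1) n) P.β (by simp) P.β_d

/-- The inclusion of `C`. -/
noncomputable abbrev inl (n : ℤ) : C.X n ⟶ P.complex.X n :=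
  attach.inl (U := C.X) (fun n => C.d (n + 1) n) P.β (by simp) P.β_d n

/-- The inclusion of the cells. -/
noncomputable abbrev inr (n : ℤ) : P.S n ⟶ P.complex.X n :=
  attach.inr (U := C.X) (fun n => C.d (n + 1) n) P.β (by simp) P.β_d n

/-- The projection to `C`. -/
noncomputable abbrev fst (n : ℤ) : P.complex.X n ⟶ C.X n :=
  attach.fst (U := C.X) (fun n => C.d (n + 1) n) P.β (by simp) P.β_d n

/-- The projection to the cells. -/
noncomputable abbrev snd (n : ℤ) : P.complex.X n ⟶ P.S n :=
  attach.snd (U := C.X) (fun n => C.d (n + 1) n) P.β (by simp) P.β_d n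

/-- The inclusion of `C`, as a chain map. -/
@[simps]
noncomputable def ι : C ⟶ P.complex where
  f n := P.inl n
  comm' := by
    rintro _ n rfl
    simp

/-- A lift out of `C` extends over each `S m` by a single sphere-to-disk lifting problem, the sphere
being mapped by `β`. -/
lemma cofibrations_ι : cofibrations 𝓧 P.ι := by
  intro E B p hp
  refine ⟨fun {f g} sq => ?_⟩
  have key (m : ℤ) : ∃ z : P.S m ⟶ E.X m, z ≫ p.f m = P.inr m ≫ g.f m ∧
      ∀ n (h : n + 1 = m), z ≫ E.d m n = eqToHom (by rw [h]) ≫ P.β n ≫ f.f n := by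
    obtain ⟨n, rfl⟩ : ∃ k, m = k + 1 + 1 := ⟨m - 2, by ring⟩
    obtain ⟨z, hz, hz'⟩ := hp _ (P.mem _) n (P.β (n + 1) ≫ f.f (n + 1))
      (P.inr (n + 1 + 1) ≫ g.f (n + 1 + 1)) (by simp [reassoc_of% P.β_d]) (by
        have := HomologicalComplex.congr_hom sq.w (n + 1)
        dsimp at this
        simp [this])
    refine ⟨z, hz', fun n' h => ?_⟩
    obtain rfl : n' = n + 1 := by omega
    simpa using hz
  choose z hz hz' using key
  replace hz' (n : ℤ) : z (n + 1) ≫ E.d (n + 1) n = P.β n ≫ f.f n := by simpa using hz' _ n rfl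
  have w (n : ℤ) : f.f n ≫ p.f n = P.inl n ≫ g.f n := HomologicalComplex.congr_hom sq.w n
  refine ⟨⟨⟨⟨fun n => P.fst n ≫ f.f n + P.snd n ≫ z n, ?_⟩, ?_, ?_⟩⟩⟩
  · rintro _ n rfl
    apply attach.hom_ext' <;> simp [hz']
  · ext n
    simp
  · ext n
    apply attach.hom_ext' <;> simp [hz, w]

/-- An `𝓧`-approximation of the test object is epic, so lifting from objects of `𝓧` suffices for
genuine exactness. -/
lemma exact (h : IsAdmissibleBalancedPair 𝓧 𝓨) (n : ℤ) :
    (ShortComplex.mk (P.β (n + 1)) (C.d (n + 1) n) (P.β_d n)).Exact := by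
  rw [ShortComplex.exact_iff_exact_up_to_refinements]
  intro T x hx
  obtain ⟨X, q, hq⟩ := h.contravariantlyFinite T
  have := h.epi_of_approximation q hq
  dsimp at x hx ⊢
  obtain ⟨l, hl⟩ := P.exists_lift n X hq.1 (q ≫ x) (by simp [hx])
  exact ⟨X, q, inferInstance, l, hl.symm⟩

end CycleApproximation

end CycleApproximations

/-! ### Killing the cohomology of `Hom(-, Y)`. -/

section Vanishing

variable {A : Type u} [Category.{v} A] [Abelian A] {𝓧 𝓨 : ObjectProperty A}

namespace CycleApproximation

variable {C : ChainComplex A ℤ} (P : CycleApproximation 𝓧 C) (Q : CycleApproximation 𝓧 P.complex)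

/-- The cells of `P` make the differential of `P.complex` map onto the cycles of `C`, and `Q.β`
covers its kernel. A map vanishing on `Q.β` therefore descends to the cycles of `C`. -/
lemma exists_factorization_through_cycles (h : IsAdmissibleBalancedPair 𝓧 𝓨) (n : ℤ) {Y : A}
    (φ : P.complex.X (n + 1 + 1) ⟶ Y) (hφ : Q.β (n + 1 + 1) ≫ φ = 0) :
    ∃ ψ : kernel (C.d (n + 1) n) ⟶ Y,
      kernel.lift (C.d (n + 1) n) (C.d (n + 1 + 1) (n + 1)) (by simp) ≫ ψ =
        P.inl (n + 1 + 1) ≫ φ := by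
  let q : P.complex.X (n + 1 + 1) ⟶ kernel (C.d (n + 1) n) :=
    kernel.lift _ (P.complex.d (n + 1 + 1) (n + 1) ≫ P.fst (n + 1)) (by simp [P.β_d])
  have hq : q ≫ kernel.ι _ ≫ P.inl (n + 1) = P.complex.d (n + 1 + 1) (n + 1) := by
    apply attach.hom_ext' <;> simp [q]
  have hβ : P.inr (n + 1 + 1) ≫ q = kernel.lift _ (P.β (n + 1)) (P.β_d n) := by
    rw [← cancel_mono (kernel.ι _)]
    simp [q]
  have : Epi (kernel.lift _ (P.β (n + 1)) (P.β_d n)) :=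
    (ShortComplex.exact_iff_epi_kernel_lift _).1 (P.exact h n)
  have : Epi q := epi_of_epi_fac hβ
  have hQ : Q.β (n + 1 + 1) ≫ q = 0 := by
    have : Q.β (n + 1 + 1) ≫ P.complex.d (n + 1 + 1) (n + 1) = 0 := Q.β_d (n + 1)
    rw [← cancel_mono (kernel.ι _)]
    simp only [q, Category.assoc, kernel.lift_ι, zero_comp]
    rw [reassoc_of% this, zero_comp]
  have hex : (ShortComplex.mk (Q.β (n + 1 + 1)) q hQ).Exact := by
    rw [ShortComplex.exact_iff_exact_up_to_refinements]
    intro T x hx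
    dsimp at x hx ⊢
    have hx' : x ≫ P.complex.d (n + 1 + 1) (n + 1) = 0 := by rw [← hq, reassoc_of% hx, zero_comp]
    exact (Q.exact h (n + 1)).exact_up_to_refinements x hx'
  have : Epi (ShortComplex.mk (Q.β (n + 1 + 1)) q hQ).g := inferInstanceAs (Epi q)
  obtain ⟨ψ, hψ⟩ : ∃ ψ, q ≫ ψ = φ := ⟨hex.desc φ hφ, hex.g_desc φ hφ⟩
  refine ⟨ψ, ?_⟩
  rw [← hψ, ← Category.assoc]
  congr 1
  rw [← cancel_mono (kernel.ι _)]
  simp [q]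

/-- A cycle of `P.complex` is a pair `(c, s)` with `d c + β s = 0`, and `c` may be arbitrary because
`β` covers the cycles of `C`. The pairs with `c = 0` form `kernel b`, the first term of a
conflation, so `ψ` on them extends to a map `θ` on the cells. Then `ψ` minus `θ` on `s` depends only
on `c`, and equals `ψ` when `s = 0`. -/
lemma exists_extension_from_cycles (h : IsAdmissibleBalancedPair 𝓧 𝓨) (n : ℤ) {Y : A} (hY : 𝓨 Y)
    (ψ : kernel (P.complex.d (n + 1 + 1) (n + 1)) ⟶ Y) :
    ∃ χ : C.X (n + 1 + 1) ⟶ Y, ∀ (T : A) (x : T ⟶ C.X (n + 1 + 1))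
      (hx : x ≫ C.d (n + 1 + 1) (n + 1) = 0),
      kernel.lift (P.complex.d (n + 1 + 1) (n + 1)) (x ≫ P.inl (n + 1 + 1))
        (by simp [reassoc_of% hx]) ≫ ψ = x ≫ χ := by
  let κ := kernel.ι (P.complex.d (n + 1 + 1) (n + 1))
  have hκ : κ ≫ P.fst (n + 1 + 1) ≫ C.d (n + 1 + 1) (n + 1) +
      κ ≫ P.snd (n + 1 + 1) ≫ P.β (n + 1) = 0 := by
    have := kernel.condition (P.complex.d (n + 1 + 1) (n + 1)) =≫ P.fst (n + 1)
    rwa [Category.assoc, attach.d_fst, Preadditive.comp_add, zero_comp] at this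
  let b := kernel.lift _ (P.β (n + 1)) (P.β_d n)
  have hb : b ≫ kernel.ι _ = P.β (n + 1) := kernel.lift_ι _ _ _
  have : Epi b := (ShortComplex.exact_iff_epi_kernel_lift _).1 (P.exact h n)
  have hL : kernel.ι b ≫ P.β (n + 1) = 0 := by rw [← hb, kernel.condition_assoc, zero_comp]
  have hS : relShortExact 𝓧 (ShortComplex.mk (kernel.ι b) b (kernel.condition b)) :=
    (relShortExact_iff _).2 ⟨
      { exact := ShortComplex.exact_kernel b
        mono_f := inferInstanceAs (Mono (kernel.ι b))
        epi_g := this }, fun X hX f => by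
      dsimp at f ⊢
      obtain ⟨l, hl⟩ := P.exists_lift n X hX (f ≫ kernel.ι _) (by simp)
      exact ⟨l, by rw [← cancel_mono (kernel.ι _), Category.assoc, hb, hl]⟩⟩
  let t : kernel b ⟶ kernel (P.complex.d (n + 1 + 1) (n + 1)) :=
    kernel.lift _ (kernel.ι b ≫ P.inr (n + 1 + 1)) (by simp [reassoc_of% hL])
  have ht : t ≫ κ = kernel.ι b ≫ P.inr (n + 1 + 1) := kernel.lift_ι _ _ _
  obtain ⟨θ, hθ⟩ := h.exists_extension hS hY (t ≫ ψ)
  dsimp at θ hθ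
  let q := κ ≫ P.fst (n + 1 + 1)
  have htq : t ≫ q = 0 := by simp [q, reassoc_of% ht]
  have : Epi q := by
    rw [epi_iff_surjective_up_to_refinements]
    intro T y
    obtain ⟨T', π, hπ, s, hs⟩ := (P.exact h n).exact_up_to_refinements
      (y ≫ C.d (n + 1 + 1) (n + 1)) (by simp)
    dsimp at s hs
    refine ⟨T', π, hπ, kernel.lift _ (π ≫ y ≫ P.inl _ - s ≫ P.inr _) ?_, ?_⟩
    · simp [reassoc_of% hs]
    · simp [q, κ]
  have hex : (ShortComplex.mk t q htq).Exact := by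
    rw [ShortComplex.exact_iff_exact_up_to_refinements]
    intro T x hx
    dsimp at x hx ⊢
    have h₁ : (x ≫ κ ≫ P.snd (n + 1 + 1)) ≫ b = 0 := by
      rw [← cancel_mono (kernel.ι _), Category.assoc, hb, zero_comp]
      have hx' : x ≫ κ ≫ P.fst (n + 1 + 1) = 0 := hx
      have := x ≫= hκ
      rw [Preadditive.comp_add, reassoc_of% hx'] at this
      simpa using this
    refine ⟨T, 𝟙 T, inferInstance, kernel.lift b _ h₁, ?_⟩
    rw [← cancel_mono κ]
    apply attach.hom_ext
    · simpa [ht] using hx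
    · simp [ht]
  have : Epi (ShortComplex.mk t q htq).g := inferInstanceAs (Epi q)
  obtain ⟨χ, hχ⟩ : ∃ χ, q ≫ χ = ψ - (κ ≫ P.snd (n + 1 + 1)) ≫ θ := by
    have : t ≫ (ψ - (κ ≫ P.snd (n + 1 + 1)) ≫ θ) = 0 := by
      simp [reassoc_of% ht, hθ]
    exact ⟨hex.desc _ this, hex.g_desc _ this⟩
  refine ⟨χ, fun T x hx => ?_⟩
  have := kernel.lift (P.complex.d (n + 1 + 1) (n + 1)) (x ≫ P.inl (n + 1 + 1))
    (by simp [reassoc_of% hx]) ≫= hχ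
  simpa [q, κ, sub_eq_zero, eq_comm] using this

end CycleApproximation

/-- Every complex admits a cofibration inducing zero on the cohomology of `Hom(-, Y)` for all `Y`
in `𝓨`. -/
lemma exists_cofibration_killing_cohomology (h : IsAdmissibleBalancedPair 𝓧 𝓨)
    (C : ChainComplex A ℤ) : ∃ (C' : ChainComplex A ℤ) (i : C ⟶ C'), cofibrations 𝓧 i ∧
      ∀ Y, 𝓨 Y → ∀ (n : ℤ) (φ : C'.X (n + 1) ⟶ Y), C'.d (n + 1 + 1) (n + 1) ≫ φ = 0 →
        ∃ χ : C.X n ⟶ Y, i.f (n + 1) ≫ φ = C.d (n + 1) n ≫ χ := by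
  -- `P₂` forces the restricted cocycle to vanish on cycles of `P₁.complex`; `P₁` then makes it
  -- factor through cycles of `P₀.complex`; `P₀` extends the resulting map from the cycles of `C` to
  -- all of `C`.
  obtain ⟨P₀⟩ := nonempty_cycleApproximation h.contravariantlyFinite C
  obtain ⟨P₁⟩ := nonempty_cycleApproximation h.contravariantlyFinite P₀.complex
  obtain ⟨P₂⟩ := nonempty_cycleApproximation h.contravariantlyFinite P₁.complex
  refine ⟨P₂.complex, P₀.ι ≫ P₁.ι ≫ P₂.ι, MorphismProperty.comp_mem _ _ _ P₀.cofibrations_ι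
    (MorphismProperty.comp_mem _ _ _ P₁.cofibrations_ι P₂.cofibrations_ι),
    fun Y hY n φ hφ => ?_⟩
  obtain ⟨n, rfl⟩ : ∃ k, n = k + 1 + 1 := ⟨n - 2, by ring⟩
  obtain ⟨ψ, hψ⟩ := P₁.exists_factorization_through_cycles P₂ h (n + 1) (P₂.inl _ ≫ φ) (by
    have := P₂.inr _ ≫= hφ
    rwa [comp_zero, attach.inr_d_assoc] at this)
  obtain ⟨χ, hχ⟩ := P₀.exists_extension_from_cycles h n hY ψ
  refine ⟨χ, ?_⟩
  rw [← hχ _ _ (by simp)]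
  have : kernel.lift (P₀.complex.d (n + 1 + 1) (n + 1)) (C.d (n + 1 + 1 + 1) (n + 1 + 1) ≫
      P₀.inl (n + 1 + 1)) (by simp) =
      P₀.inl (n + 1 + 1 + 1) ≫
        kernel.lift _ (P₀.complex.d (n + 1 + 1 + 1) (n + 1 + 1)) (by simp) := by
    rw [← cancel_mono (kernel.ι _)]
    simp
  rw [this, Category.assoc, hψ]
  simp

end Vanishing

/-! ### From left `𝓨`-acyclicity to right `𝓧`-acyclicity. -/

section LeftAcyclicity

variable {A : Type u} [Category.{v} A] [Abelian A] {𝓧 𝓨 : ObjectProperty A}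

/-- Embedding cokernels of the differentials into objects of `𝓨` gives exactness in `A`. The complex
then breaks into short exact sequences of cycles, and balance transfers their exactness under
`Hom(-, Y)` to `Hom(X, -)`. -/
lemma acyclicTilde_of_left (h : IsAdmissibleBalancedPair 𝓧 𝓨) (E : ChainComplex A ℤ)
    (hE : ∀ Y, 𝓨 Y → ∀ (n : ℤ) (φ : E.X (n + 1) ⟶ Y), E.d (n + 1 + 1) (n + 1) ≫ φ = 0 →
      ∃ χ : E.X n ⟶ Y, E.d (n + 1) n ≫ χ = φ) : acyclicTilde 𝓧 E := by
  have hex (n : ℤ) :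
      (ShortComplex.mk (E.d (n + 1 + 1) (n + 1)) (E.d (n + 1) n) (by simp)).Exact := by
    obtain ⟨Y, j, hj⟩ := h.covariantlyFinite (cokernel (E.d (n + 1 + 1) (n + 1)))
    have := h.mono_of_approximation j hj
    obtain ⟨χ, hχ⟩ := hE Y hj.1 n (cokernel.π _ ≫ j) (by simp)
    rw [ShortComplex.exact_iff_exact_up_to_refinements]
    intro T x hx
    dsimp at x hx ⊢
    refine (ShortComplex.exact_cokernel _).exact_up_to_refinements x ?_
    dsimp
    rw [← cancel_mono j, Category.assoc, ← hχ, reassoc_of% hx, zero_comp, zero_comp]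
  have hepi (n : ℤ) : Epi (kernel.lift (E.d (n + 1) n) (E.d (n + 1 + 1) (n + 1)) (by simp)) :=
    (ShortComplex.exact_iff_epi_kernel_lift _).1 (hex n)
  rw [acyclicTilde_iff]
  intro X hX n x hx
  let p := kernel.lift (E.d (n + 1) n) (E.d (n + 1 + 1) (n + 1)) (by simp)
  have hp : p ≫ kernel.ι _ = E.d (n + 1 + 1) (n + 1) := kernel.lift_ι _ _ _
  have hιp : kernel.ι (E.d (n + 1 + 1) (n + 1)) ≫ p = 0 := by
    rw [← cancel_mono (kernel.ι _), Category.assoc, hp, kernel.condition, zero_comp]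
  let S := ShortComplex.mk (kernel.ι (E.d (n + 1 + 1) (n + 1))) p hιp
  have hS : S.ShortExact :=
    { exact := by
        rw [ShortComplex.exact_iff_exact_up_to_refinements]
        intro T y hy
        dsimp [S] at y hy ⊢
        refine (ShortComplex.exact_kernel _).exact_up_to_refinements y ?_
        dsimp
        rw [← hp, reassoc_of% hy, zero_comp]
      mono_f := inferInstanceAs (Mono (kernel.ι _))
      epi_g := hepi n }
  -- A map from the cycles to `Y` pulls back along the epimorphism `e` to a cocycle; its primitive
  -- is the required extension.
  have hS' := h.relShortExact_of_exists_extension hS fun Y hY g => by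
    have := hepi (n + 1)
    let e := kernel.lift (E.d (n + 1 + 1) (n + 1)) (E.d (n + 1 + 1 + 1) (n + 1 + 1)) (by simp)
    have he : e ≫ kernel.ι _ = E.d (n + 1 + 1 + 1) (n + 1 + 1) := kernel.lift_ι _ _ _
    obtain ⟨χ, hχ⟩ := hE Y hY (n + 1 + 1) (e ≫ g) (by
      have : E.d (n + 1 + 1 + 1 + 1) (n + 1 + 1 + 1) ≫ e = 0 := by
        rw [← cancel_mono (kernel.ι _), Category.assoc, he]
        simp
      rw [reassoc_of% this, zero_comp])
    exact ⟨χ, by rw [← cancel_epi e, ← hχ, ← he, Category.assoc]⟩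
  obtain ⟨l, hl⟩ := ((relShortExact_iff S).1 hS').2 X hX (kernel.lift _ x hx)
  dsimp [S] at l hl
  exact ⟨l, by rw [← hp, reassoc_of% hl, kernel.lift_ι]⟩

end LeftAcyclicity

/-! ### Dependent choice and maps out of sequential colimits. -/

section Sequences

lemma exists_sequence {T : ℕ → Type*} (P : ∀ k, T k → Prop) (R : ∀ k, T k → T (k + 1) → Prop)
    (t₀ : T 0) (h₀ : P 0 t₀) (h : ∀ k t, P k t → ∃ t', P (k + 1) t' ∧ R k t t') :
    ∃ s : ∀ k, T k, s 0 = t₀ ∧ (∀ k, P k (s k)) ∧ ∀ k, R k (s k) (s (k + 1)) := by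
  choose next hnext using h
  let s (k : ℕ) : {t : T k // P k t} :=
    Nat.rec ⟨t₀, h₀⟩ (fun k t => ⟨next k t.1 t.2, (hnext k t.1 t.2).1⟩) k
  exact ⟨fun k => (s k).1, rfl, fun k => (s k).2, fun k => (hnext k (s k).1 (s k).2).2⟩

variable {C : Type*} [Category* C]

lemma exists_desc_of_sequence {F : ℕ ⥤ C} {c : Cocone F} (hc : IsColimit c) {W : C}
    (g : ∀ k, F.obj k ⟶ W) (hg : ∀ k, F.map (homOfLE (Nat.le_add_right k 1)) ≫ g (k + 1) = g k) :
    ∃ l : c.pt ⟶ W, ∀ k, c.ι.app k ≫ l = g k :=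
  ⟨hc.desc ⟨W, NatTrans.ofSequence g (fun k => by simp [hg])⟩, fun k => hc.fac _ k⟩

end Sequences

/-! ### The telescope of cofibrations. -/

section Telescope

variable {A : Type u} [Category.{v} A] [Abelian A] {𝓧 𝓨 : ObjectProperty A}

lemma cofibrations_of_sequence {F : ℕ ⥤ ChainComplex A ℤ} {c : Cocone F} (hc : IsColimit c)
    (hF : ∀ k, cofibrations 𝓧 (F.map (homOfLE (Nat.le_add_right k 1)))) :
    cofibrations 𝓧 (c.ι.app 0) := by
  intro E B p hp
  refine ⟨fun {f g} sq => ?_⟩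
  obtain ⟨s, hs₀, hs, hR⟩ := exists_sequence (T := fun k => F.obj k ⟶ E)
    (fun k s => s ≫ p = c.ι.app k ≫ g)
    (fun k s s' => F.map (homOfLE (Nat.le_add_right k 1)) ≫ s' = s) f sq.w (fun k s hs => by
      obtain ⟨s', h₁, h₂⟩ := exists_lift_of_cofibrations (hF k) hp (f := s)
        (g := c.ι.app (k + 1) ≫ g) (by rw [hs, c.w_assoc])
      exact ⟨s', h₂, h₁⟩)
  obtain ⟨l, hl⟩ := exists_desc_of_sequence hc s hR
  exact ⟨⟨⟨l, by rw [hl, hs₀], hc.hom_ext fun k => by rw [reassoc_of% (hl k), hs]⟩⟩⟩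

/-- Each restriction of `φ` to a stage has a primitive, since it factors through the next stage. The
primitives must be made compatible; zero transition maps on cohomology and degreewise splittings
remove this `lim¹` obstruction. -/
lemma left_acyclic_of_sequence {F : ℕ ⥤ ChainComplex A ℤ} {c : Cocone F} (hc : IsColimit c)
    [∀ n, PreservesColimit F (HomologicalComplex.eval A (ComplexShape.down ℤ) n)]
    (hF : ∀ k, cofibrations 𝓧 (F.map (homOfLE (Nat.le_add_right k 1)))) {Y : A}
    (hY : ∀ (k : ℕ) (n : ℤ) (φ : (F.obj (k + 1)).X (n + 1) ⟶ Y),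
      (F.obj (k + 1)).d (n + 1 + 1) (n + 1) ≫ φ = 0 → ∃ χ : (F.obj k).X n ⟶ Y,
        (F.map (homOfLE (Nat.le_add_right k 1))).f (n + 1) ≫ φ = (F.obj k).d (n + 1) n ≫ χ)
    (n : ℤ) (φ : c.pt.X (n + 1) ⟶ Y) (hφ : c.pt.d (n + 1 + 1) (n + 1) ≫ φ = 0) :
    ∃ χ : c.pt.X n ⟶ Y, c.pt.d (n + 1) n ≫ χ = φ := by
  let f (k : ℕ) : F.obj k ⟶ F.obj (k + 1) := F.map (homOfLE (Nat.le_add_right k 1))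
  let a (k : ℕ) : (F.obj k).X (n + 1) ⟶ Y := (c.ι.app k).f (n + 1) ≫ φ
  have ha (k : ℕ) : (F.obj k).d (n + 1 + 1) (n + 1) ≫ a k = 0 := by
    simp [a, ← HomologicalComplex.Hom.comm_assoc, hφ]
  have hfa (k : ℕ) : (f k).f (n + 1) ≫ a (k + 1) = a k := by
    simp only [a, f]
    rw [← HomologicalComplex.comp_f_assoc, c.w]
  have hγ (k : ℕ) : ∃ γ : (F.obj k).X n ⟶ Y, (F.obj k).d (n + 1) n ≫ γ = a k := by
    obtain ⟨γ, hγ⟩ := hY k n (a (k + 1)) (ha _)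
    exact ⟨γ, by rw [← hγ]; exact hfa k⟩
  obtain ⟨n, rfl⟩ : ∃ m, n = m + 1 := ⟨n - 1, by ring⟩
  obtain ⟨b₀, hb₀⟩ := hγ 1
  -- `b k` lives on stage `k + 1`, because compatibility is achieved only after restriction along `f
  -- k`; the family that glues is `f k ≫ b k`.
  obtain ⟨b, -, hb, hR⟩ := exists_sequence (T := fun k => (F.obj (k + 1)).X (n + 1) ⟶ Y)
    (fun k b => (F.obj (k + 1)).d (n + 1 + 1) (n + 1) ≫ b = a (k + 1))
    (fun k b b' => (f k).f (n + 1) ≫ (f (k + 1)).f (n + 1) ≫ b' = (f k).f (n + 1) ≫ b)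
    b₀ hb₀ (fun k b hb => by
      obtain ⟨γ, hγ⟩ := hγ (k + 1 + 1)
      -- Two primitives differ by a cocycle, whose restriction to stage `k` is the coboundary of
      -- some `η`. The retractions extend `η` to stage `k + 2`, where its coboundary corrects `γ`
      -- and leaves it a primitive.
      obtain ⟨η, hη⟩ := hY k n (b - (f (k + 1)).f (n + 1) ≫ γ) (by
        rw [Preadditive.comp_sub, hb, ← HomologicalComplex.Hom.comm_assoc, hγ, hfa, sub_self])
      obtain ⟨r₁, hr₁⟩ := exists_retraction_of_cofibrations (hF k) n
      obtain ⟨r₂, hr₂⟩ := exists_retraction_of_cofibrations (hF (k + 1)) n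
      refine ⟨γ + (F.obj (k + 1 + 1)).d (n + 1) n ≫ r₂ ≫ r₁ ≫ η, by simp [hγ], ?_⟩
      have : (f k).f (n + 1) ≫ (f (k + 1)).f (n + 1) ≫
          (F.obj (k + 1 + 1)).d (n + 1) n ≫ r₂ ≫ r₁ ≫ η = (F.obj k).d (n + 1) n ≫ η := by
        rw [HomologicalComplex.Hom.comm_assoc, HomologicalComplex.Hom.comm_assoc,
          reassoc_of% hr₂, reassoc_of% hr₁]
      rw [Preadditive.comp_add, Preadditive.comp_add, this, ← hη, Preadditive.comp_sub]
      abel)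
  have hc' (m : ℤ) := isColimitOfPreserves (HomologicalComplex.eval A (ComplexShape.down ℤ) m) hc
  obtain ⟨χ, hχ⟩ : ∃ χ : c.pt.X (n + 1) ⟶ Y, ∀ k,
      (c.ι.app k).f (n + 1) ≫ χ = (f k).f (n + 1) ≫ b k :=
    exists_desc_of_sequence (hc' (n + 1)) (fun k => (f k).f (n + 1) ≫ b k) hR
  refine ⟨χ, (hc' (n + 1 + 1)).hom_ext fun k => ?_⟩
  change (c.ι.app k).f (n + 1 + 1) ≫ c.pt.d (n + 1 + 1) (n + 1) ≫ χ = a k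
  have : (c.ι.app k).f (n + 1 + 1) ≫ c.pt.d (n + 1 + 1) (n + 1) =
    (F.obj k).d (n + 1 + 1) (n + 1) ≫ (c.ι.app k).f (n + 1) := (c.ι.app k).comm _ _
  rw [reassoc_of% this, hχ, ← HomologicalComplex.Hom.comm_assoc, hb, hfa]

lemma exists_cofibration_to_acyclic [HasColimits A] (h : IsAdmissibleBalancedPair 𝓧 𝓨)
    (M : ChainComplex A ℤ) :
    ∃ (E : ChainComplex A ℤ) (i : M ⟶ E), cofibrations 𝓧 i ∧ acyclicTilde 𝓧 E := by
  choose T i hi hi' using exists_cofibration_killing_cohomology h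
  let X (k : ℕ) : ChainComplex A ℤ := Nat.rec M (fun _ => T) k
  let f (k : ℕ) : X k ⟶ X (k + 1) := i (X k)
  let F := Functor.ofSequence f
  have hFf (k : ℕ) : F.map (homOfLE (Nat.le_add_right k 1)) = f k :=
    Functor.ofSequence_map_homOfLE_succ f k
  have : HasColimitsOfSize.{0, 0} A := hasColimitsOfSizeShrink.{0, 0, v, v} A
  have hF (k : ℕ) : cofibrations 𝓧 (F.map (homOfLE (Nat.le_add_right k 1))) := by
    rw [hFf]
    exact hi _
  refine ⟨colimit F, colimit.ι F 0, cofibrations_of_sequence (colimit.isColimit F) hF,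
    acyclicTilde_of_left h _ fun Y hY n φ hφ =>
      left_acyclic_of_sequence (colimit.isColimit F) hF (fun k n φ hφ => ?_) n φ hφ⟩
  rw [hFf]
  exact hi' _ Y hY n φ hφ

end Telescope

/-! ### Approximation sequences and the cotorsion pair. -/

section CotorsionPair

variable {A : Type u} [Category.{v} A] [Abelian A] {𝓧 𝓨 : ObjectProperty A}

/-- A lift of `S.X₂` extending the zero map on `S.X₁` descends to the cokernel. -/
lemma cofibrations_from_isZero_of_shortExact {S : ShortComplex (ChainComplex A ℤ)}
    (hS : S.ShortExact) (hf : cofibrations 𝓧 S.f) {Z : ChainComplex A ℤ} (hZ : IsZero Z)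
    (j : Z ⟶ S.X₃) : cofibrations 𝓧 j := by
  intro E B p hp
  refine ⟨fun {_ g} _ => ?_⟩
  have := hS.epi_g
  obtain ⟨l, hl, hl'⟩ := exists_lift_of_cofibrations hf hp (f := 0) (g := S.g ≫ g) (by simp)
  refine ⟨⟨⟨hS.exact.desc l hl, hZ.eq_of_src _ _, ?_⟩⟩⟩
  rw [← cancel_epi S.g, ShortComplex.Exact.g_desc_assoc, hl']

/-- The cofibration property is kept in the conclusion because `exists_precover` pushes out along
this map. -/
lemma exists_preenvelope [HasColimits A] [𝓧.IsStableUnderRetracts]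
    (h : IsAdmissibleBalancedPair 𝓧 𝓨) (M : ChainComplex A ℤ) :
    ∃ (K F : ChainComplex A ℤ) (i : M ⟶ K) (p : K ⟶ F) (w : i ≫ p = 0),
      (chExact 𝓧).conflation (ShortComplex.mk i p w) ∧ dgTilde 𝓧 F ∧ acyclicTilde 𝓧 K ∧
        cofibrations 𝓧 i := by
  obtain ⟨K, i, hi, hK⟩ := exists_cofibration_to_acyclic h M
  have hmono (n : ℤ) : Mono (i.f n) := by
    obtain ⟨r, hr⟩ := exists_retraction_of_cofibrations hi n
    exact mono_of_mono_fac hr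
  have : Mono i := HomologicalComplex.mono_of_mono_f i hmono
  have hS : (ShortComplex.mk i (cokernel.π i) (cokernel.condition i)).ShortExact :=
    { exact := ShortComplex.exact_cokernel i
      mono_f := this
      epi_g := inferInstanceAs (Epi (cokernel.π i)) }
  obtain ⟨Z, hZ⟩ : ∃ Z : ChainComplex A ℤ, IsZero Z := HasZeroObject.zero
  refine ⟨K, cokernel i, i, cokernel.π i, cokernel.condition i,
    (chExact_conflation_iff _).2 ⟨hS, fun n X _ f => ?_⟩,
    dgTilde_of_cofibrations h.contravariantlyFinite hZ
      (cofibrations_from_isZero_of_shortExact hS hi hZ (hZ.to_ _)), hK, hi⟩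
  obtain ⟨r, hr⟩ := exists_retraction_of_cofibrations hi n
  have hSn := (HomologicalComplex.shortExact_iff_degreewise_shortExact _).1 hS n
  have := hSn.epi_g
  let σ := ShortComplex.Splitting.ofExactOfRetraction _ hSn.exact r hr this
  obtain ⟨s, hs⟩ : ∃ s : (cokernel i).X n ⟶ K.X n, s ≫ (cokernel.π i).f n = 𝟙 _ := ⟨σ.s, σ.s_g⟩
  dsimp at f ⊢
  exact ⟨f ≫ s, by rw [Category.assoc, hs, Category.comp_id]⟩

/-- Lift the boundary of `y` to a cycle first, then `y` itself with that prescribed boundary. -/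
lemma exists_lift_of_trivialFibrations {E B : ChainComplex A ℤ} {p : E ⟶ B}
    (hp : trivialFibrations 𝓧 p) {X : A} (hX : 𝓧 X) (n : ℤ) (y : X ⟶ B.X n) :
    ∃ z : X ⟶ E.X n, z ≫ p.f n = y := by
  obtain ⟨n, rfl⟩ : ∃ k, n = k + 1 + 1 := ⟨n - 2, by ring⟩
  obtain ⟨m, rfl⟩ : ∃ k, n = k + 1 := ⟨n - 1, by ring⟩
  obtain ⟨x, hx, hx'⟩ := hp X hX m 0 (y ≫ B.d _ _) (by simp) (by simp)
  obtain ⟨z, -, hz⟩ := hp X hX _ x y hx hx'.symm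
  exact ⟨z, hz⟩

lemma cofibrations_to_contractible {V : ℤ → A} (hV : ∀ n, 𝓧 (V n)) {Z : ChainComplex A ℤ}
    (hZ : IsZero Z) (j : Z ⟶ contractible V) : cofibrations 𝓧 j := by
  intro E B p hp
  refine ⟨fun {_ g} _ => ?_⟩
  choose z hz using fun n =>
    exists_lift_of_trivialFibrations hp (hV n) n (contractible.inr V n ≫ g.f n)
  refine ⟨⟨⟨contractible.desc z, hZ.eq_of_src _ _, ?_⟩⟩⟩
  ext n
  apply contractible.hom_ext'
  · simp only [contractible.desc, HomologicalComplex.comp_f, Category.assoc,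
      Preadditive.add_comp, Preadditive.comp_add, contractible.inl_fst_assoc,
      contractible.inl_snd_assoc, add_zero, ← HomologicalComplex.Hom.comm, reassoc_of% hz]
    rw [HomologicalComplex.Hom.comm, contractible.inr_d_assoc]
  · simp [contractible.desc, hz]

/-- Cover `M` by a contractible complex on degreewise approximations, then push out along a
cofibration from the kernel to an acyclic `K`. The cokernel remains `M`, the kernel becomes `K`, and
the middle term is cofibrant as a pushout of a cofibration out of a cofibrant complex. -/
lemma exists_precover [HasColimits A] [𝓧.IsStableUnderRetracts]
    (h : IsAdmissibleBalancedPair 𝓧 𝓨) (M : ChainComplex A ℤ) :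
    ∃ (K F : ChainComplex A ℤ) (i : K ⟶ F) (p : F ⟶ M) (w : i ≫ p = 0),
      (chExact 𝓧).conflation (ShortComplex.mk i p w) ∧ dgTilde 𝓧 F ∧ acyclicTilde 𝓧 K := by
  choose V q hq using fun n => h.contravariantlyFinite (M.X n)
  let e : contractible V ⟶ M := contractible.desc q
  have he (n : ℤ) : contractible.inr V n ≫ e.f n = q n := by simp [e, contractible.desc]
  have hepi (n : ℤ) : Epi (e.f n) := by
    have := h.epi_of_approximation _ (hq n)
    exact epi_of_epi_fac (he n)
  have : Epi e := HomologicalComplex.epi_of_epi_f e hepi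
  obtain ⟨K, _, i, _, _, -, -, hK, hi⟩ := exists_preenvelope h (kernel e)
  have hmono : Mono i := by
    have (n : ℤ) : Mono (i.f n) := by
      obtain ⟨r, hr⟩ := exists_retraction_of_cofibrations hi n
      exact mono_of_mono_fac hr
    exact HomologicalComplex.mono_of_mono_f i this
  let π : pushout i (kernel.ι e) ⟶ M := pushout.desc 0 e (by simp)
  have hπ : pushout.inr i (kernel.ι e) ≫ π = e := pushout.inr_desc _ _ _
  have w : pushout.inl i (kernel.ι e) ≫ π = 0 := pushout.inl_desc _ _ _
  have : Epi π := epi_of_epi_fac hπ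
  have hcoker : IsColimit (CokernelCofork.ofπ π w) :=
    CokernelCofork.IsColimit.ofπ' _ _ fun {T} m hm => by
      have hm' : kernel.ι e ≫ pushout.inr i (kernel.ι e) ≫ m = 0 := by
        rw [← pushout.condition_assoc, hm, comp_zero]
      have hd : e ≫ (ShortComplex.exact_kernel e).desc _ hm' =
        pushout.inr i (kernel.ι e) ≫ m := (ShortComplex.exact_kernel e).g_desc _ hm'
      refine ⟨(ShortComplex.exact_kernel e).desc _ hm', ?_⟩
      apply pushout.hom_ext
      · rw [reassoc_of% w, zero_comp, hm]
      · rw [reassoc_of% hπ, hd]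
  obtain ⟨Z, hZ⟩ : ∃ Z : ChainComplex A ℤ, IsZero Z := HasZeroObject.zero
  refine ⟨K, _, pushout.inl i (kernel.ι e), π, w, (chExact_conflation_iff _).2 ⟨
    { exact := ShortComplex.exact_of_g_is_cokernel _ hcoker
      mono_f := inferInstanceAs (Mono (pushout.inl i (kernel.ι e)))
      epi_g := this }, fun n X hX f => ?_⟩,
    dgTilde_of_cofibrations h.contravariantlyFinite hZ (MorphismProperty.comp_mem _ _ _
      (cofibrations_to_contractible (fun n => (hq n).1) hZ (hZ.to_ _))
      (MorphismProperty.of_isPushout (IsPushout.of_hasPushout i (kernel.ι e)).flip hi)), hK⟩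
  -- The approximation `q n` factors through `π`, which is why `π` stays surjective on maps from
  -- `𝓧`.
  obtain ⟨l, hl⟩ := (hq n).2 X hX f
  refine ⟨l ≫ contractible.inr V n ≫ (pushout.inr i (kernel.ι e)).f n, ?_⟩
  dsimp
  rw [Category.assoc, Category.assoc, ← HomologicalComplex.comp_f, hπ, he, hl]

/-- Comparison with the biproduct extension yields a section; conversely, sections yield a map
between any two extensions, invertible by the short five lemma. -/
lemma extVanishes_iff (F K : ChainComplex A ℤ) :
    (chExact 𝓧).ExtVanishes F K ↔ ∀ (M : ChainComplex A ℤ) (i : K ⟶ M) (p : M ⟶ F) (w : i ≫ p = 0),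
      (chExact 𝓧).conflation (ShortComplex.mk i p w) → ∃ t : F ⟶ M, t ≫ p = 𝟙 F := by
  constructor
  · intro hext M i p w hS
    have hb : (chExact 𝓧).conflation
        (ShortComplex.mk (biprod.inl : K ⟶ K ⊞ F) biprod.snd biprod.inl_snd) :=
      (chExact_conflation_iff _).2 ⟨(ShortComplex.Splitting.ofHasBinaryBiproduct K F).shortExact,
        fun n X _ f => ⟨f ≫ (biprod.inr : F ⟶ K ⊞ F).f n, by
          dsimp
          rw [Category.assoc, ← HomologicalComplex.comp_f, biprod.inr_snd,
            HomologicalComplex.id_f, Category.comp_id]⟩⟩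
    have hext' : Subsingleton ((chExact 𝓧).YonedaExt F K) := hext
    obtain ⟨e, -, he⟩ := Quotient.exact (s := (chExact 𝓧).extensionSetoid F K)
      (Subsingleton.elim (α := (chExact 𝓧).YonedaExt F K)
        (Quotient.mk _ ⟨M, i, p, w, hS⟩) (Quotient.mk _ ⟨_, _, _, _, hb⟩))
    dsimp at e he
    exact ⟨biprod.inr ≫ e.inv, by rw [← he]; simp⟩
  · intro hsplit
    refine ⟨fun a b => ?_⟩
    induction a using Quotient.inductionOn with | _ E
    induction b using Quotient.inductionOn with | _ E'
    apply Quotient.sound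
    obtain ⟨t, ht⟩ := hsplit _ _ _ _ E.conflation
    obtain ⟨t', ht'⟩ := hsplit _ _ _ _ E'.conflation
    have hE := ((chExact_conflation_iff _).1 E.conflation).1
    have hE' := ((chExact_conflation_iff _).1 E'.conflation).1
    let σ := ShortComplex.Splitting.ofExactOfSection _ hE.exact t ht hE.mono_f
    have hσ : E.i ≫ σ.r = 𝟙 _ := σ.f_r
    let φ : E.middle ⟶ E'.middle := σ.r ≫ E'.i + E.p ≫ t'
    have h₁ : E.i ≫ φ = E'.i := by
      simp [φ, reassoc_of% hσ, reassoc_of% E.zero]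
    have h₂ : φ ≫ E'.p = E.p := by
      simp [φ, ht', E'.zero]
    let Φ : ShortComplex.mk E.i E.p E.zero ⟶ ShortComplex.mk E'.i E'.p E'.zero :=
      { τ₁ := 𝟙 _
        τ₂ := φ
        τ₃ := 𝟙 _ }
    have : IsIso φ := ShortComplex.isIso₂_of_shortExact_of_isIso₁₃' Φ hE hE'
      (inferInstanceAs (IsIso (𝟙 K))) (inferInstanceAs (IsIso (𝟙 F)))
    exact ⟨asIso φ, h₁, h₂⟩

lemma dgTilde_of_retract [𝓧.IsStableUnderRetracts] {F F' : ChainComplex A ℤ} (r : Retract F F')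
    (hF' : dgTilde 𝓧 F') : dgTilde 𝓧 F := by
  refine ⟨fun n => 𝓧.prop_of_retract
    (r.map (HomologicalComplex.eval A (ComplexShape.down ℤ) n)) (hF'.1 n), fun E hE f => ?_⟩
  obtain ⟨H⟩ := hF'.2 E hE (r.r ≫ f)
  exact ⟨(Homotopy.ofEq (by simp)).trans ((H.compLeft r.i).trans (Homotopy.ofEq (by simp)))⟩

lemma acyclicTilde_of_retract {E E' : ChainComplex A ℤ} (r : Retract E E')
    (hE' : acyclicTilde 𝓧 E') : acyclicTilde 𝓧 E := by
  rw [acyclicTilde_iff] at hE' ⊢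
  intro X hX n x hx
  obtain ⟨y, hy⟩ := hE' X hX n (x ≫ r.i.f _) (by simp [reassoc_of% hx])
  have hr : r.i.f (n + 1) ≫ r.r.f (n + 1) = 𝟙 _ := by
    rw [← HomologicalComplex.comp_f, r.retract, HomologicalComplex.id_f]
  exact ⟨y ≫ r.r.f _, by rw [Category.assoc, HomologicalComplex.Hom.comm, reassoc_of% hy, hr,
    Category.comp_id]⟩

end CotorsionPair

end RelHom

/-- For an admissible balanced pair `(𝓧, 𝓨)` of classes of objects closed under direct summands in
a complete and cocomplete abelian category, `(𝓔-dg𝓧~, 𝓔~)` is a complete cotorsion pair in the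
exact category `Ch(A, 𝓔)`. -/
theorem proposition3p8 {A : Type u} [Category.{v} A] [Abelian A] [HasLimits A] [HasColimits A]
    (𝓧 𝓨 : ObjectProperty A) [𝓧.IsStableUnderRetracts] [𝓨.IsStableUnderRetracts]
    (h : RelHom.IsAdmissibleBalancedPair 𝓧 𝓨) :
    (RelHom.chExact 𝓧).IsCompleteCotorsionPair (RelHom.dgTilde 𝓧) (RelHom.acyclicTilde 𝓧) := by
  have hext {F E : ChainComplex A ℤ} (hF : RelHom.dgTilde 𝓧 F) (hE : RelHom.acyclicTilde 𝓧 E) :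
      (RelHom.chExact 𝓧).ExtVanishes F E :=
    (RelHom.extVanishes_iff F E).2 fun _ _ _ _ hS => RelHom.exists_section_of_dgTilde hS hE hF
  refine ⟨⟨?_, ?_⟩, fun M => RelHom.exists_precover h M, fun M => ?_⟩
  -- Vanishing of `Ext¹` splits the precover sequence, making `F` a retract of its middle term; the
  -- other equality uses the preenvelope sequence in the same way.
  · refine funext fun F => propext ⟨fun hF E hE => hext hF hE, fun hF => ?_⟩
    obtain ⟨K, F', i, p, w, hS, hF', hK⟩ := RelHom.exists_precover h F
    obtain ⟨t, ht⟩ := (RelHom.extVanishes_iff F K).1 (hF K hK) _ _ _ _ hS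
    exact RelHom.dgTilde_of_retract ⟨t, p, ht⟩ hF'
  · refine funext fun E => propext ⟨fun hE F hF => hext hF hE, fun hE => ?_⟩
    obtain ⟨K, F, i, p, w, hS, hF, hK, -⟩ := RelHom.exists_preenvelope h E
    obtain ⟨t, ht⟩ := (RelHom.extVanishes_iff F E).1 (hE F hF) _ _ _ _ hS
    have hS' := ((RelHom.chExact_conflation_iff _).1 hS).1
    let σ := ShortComplex.Splitting.ofExactOfSection _ hS'.exact t ht hS'.mono_f
    exact RelHom.acyclicTilde_of_retract ⟨i, σ.r, σ.f_r⟩ hK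
  · obtain ⟨K, F, i, p, w, hS, hF, hK, -⟩ := RelHom.exists_preenvelope h M
    exact ⟨K, F, i, p, w, hS, hF, hK⟩
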